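/- **Theorem (Learnability of stable local shift-invariant discretizations).** Let $d\ge 0$ and let $A_0,A_1\in\mathbb R^{d\times d}$ be symmetric and commuting. Let $A$ be the block three-point stencil operator on $\ell^2(\mathbb Z;\mathbb R^d)$ ($\mathbb R^d$ with the Euclidean norm), $$(Au)[i]=A_0u[i]+A_1\bigl(u[i-1]+u[i+1]\bigr).$$ Assume that every pair $(a,b)$ of corresponding eigenvalues (i.e. $A_0v=av$ and $A_1v=bv$ for a common vector $v\neq0$) satisfies $a>2|b|$. Notation. For $N\ge 0$ let $\phi_1,\dots,\phi_{N+1}\in\mathbb R^{N+1}$ (entries indexed by $0,\dots,N$) be the Hilbert/USB modes: orthonormal eigenvectors of the $(N+1)\times(N+1)$ Hilbert matrix $H_{ij}=1/(i+j-1)$, $1\le i,j\le N+1$, listed in nonincreasing order of their eigenvalues (any such choice). For $L\le N+1$ and $\Theta_1,\dots,\Theta_L\in\mathbb R^{d\times d}$, the SFO-parameterized operator $M_L$ on the window $\{-N,\dots,N\}$ is $$(M_Lu)[i]=\sum_{|t|\le N}\Bigl(\sum_{l=1}^{L}\phi_l[|t|]\,\Theta_l\Bigr)u[i-t].$$ Then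 $A$ is invertible as a bounded operator on $\ell^2(\mathbb Z;\mathbb R^d)$. Let $G[t]\in\mathbb R^{d\times d}$ be the Green's kernel of $A$ (the columns of $G$ are $A^{-1}(\delta_0e_q)$, $q=1,\dots,d$), and let $(A^{-1})_Nu[i]=\sum_{|t|\le N}G[t]u[i-t]$ be the convolution with its truncation to the window. There is a constant $C>0$, depending only on $A_0,A_1$, such that for every $\varepsilon>0$, every $N\ge0$ and every choice of the modes there are $$L\le\min\Bigl\{N+1,\ C\,\bigl(\log(N+2)\bigr)^2\log\bigl(2+\tfrac1\varepsilon\bigr)\Bigr\}$$ and $\Theta_1,\dots,\Theta_L\in\mathbb R^{d\times d}$ such that, in operator norm on $\ell^2(\mathbb Z;\mathbb R^d)$, $$\|(A^{-1})_N-M_L\|\le\varepsilon,$$ and such that moreover the same $M_L$ satisfies $$\|A^{-1}-M_L\|\le\varepsilon\qquad\text{whenever } N\ge C\log\bigl(2+\tfrac1\varepsilon\bigr).$$ In particular, with $N=\lceil C\log(2+1/\varepsilon)\rceil$, the full inverse is approximated to accuracy $\varepsilon$ with $L=\widetilde O(\log(1/\varepsilon))$ modes, the $\widetilde O$ hiding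 a factor polylogarithmic in $\log(1/\varepsilon)$. -/

import Mathlib

noncomputable section

/-- The space `ℓ²(ℤ; ℝ^d)` of square-summable vector fields on the grid `ℤ`; the values carry the
Euclidean norm. -/
abbrev GridL2 (d : ℕ) : Type := lp (fun _ : ℤ => EuclideanSpace ℝ (Fin d)) 2

/-- The shift `(τ_s u)[i] = u[i - s]` on `ℓ²(ℤ; ℝ^d)`. -/
def gridShift (d : ℕ) (s : ℤ) : GridL2 d →L[ℝ] GridL2 d :=
  LinearMap.mkContinuous
    { toFun := fun u => ⟨fun i => u (i - s), by
        have h := (lp.memℓp u).summable (by norm_num)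
        exact memℓp_gen ((Equiv.subRight s).summable_iff.mpr h)⟩
      map_add' := fun _ _ => rfl
      map_smul' := fun _ _ => rfl } 1 (fun u => by
        rw [one_mul, lp.norm_eq_tsum_rpow (by norm_num), lp.norm_eq_tsum_rpow (by norm_num)]
        exact le_of_eq (congrArg (fun x : ℝ => x ^ (1 / (2 : ENNReal).toReal))
          ((Equiv.subRight s).tsum_eq (fun i => ‖u i‖ ^ (2 : ENNReal).toReal))))

/-- The pointwise action `(B u)[i] = B (u[i])` of a `d × d` matrix on `ℓ²(ℤ; ℝ^d)`. -/
def gridMatrix {d : ℕ} (B : Matrix (Fin d) (Fin d) ℝ) : GridL2 d →L[ℝ] GridL2 d :=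
  lp.mapCLM 2 (fun _ : ℤ => Matrix.toEuclideanCLM (n := Fin d) (𝕜 := ℝ) B)
    (norm_nonneg (Matrix.toEuclideanCLM (n := Fin d) (𝕜 := ℝ) B)) (fun _ => le_rfl)

theorem gridShift_apply {d : ℕ} (s : ℤ) (u : GridL2 d) (i : ℤ) :
    gridShift d s u i = u (i - s) := rfl

theorem gridMatrix_apply {d : ℕ} (B : Matrix (Fin d) (Fin d) ℝ) (u : GridL2 d) (i : ℤ) :
    gridMatrix B u i = Matrix.toEuclideanCLM (n := Fin d) (𝕜 := ℝ) B (u i) := rfl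

/-- The block three-point stencil operator `(A u)[i] = A₀ u[i] + A₁ (u[i-1] + u[i+1])`. -/
def stencilOperator {d : ℕ} (A₀ A₁ : Matrix (Fin d) (Fin d) ℝ) : GridL2 d →L[ℝ] GridL2 d :=
  gridMatrix A₀ + (gridMatrix A₁).comp (gridShift d 1 + gridShift d (-1))

theorem stencilOperator_apply {d : ℕ} (A₀ A₁ : Matrix (Fin d) (Fin d) ℝ) (u : GridL2 d) (i : ℤ) :
    stencilOperator A₀ A₁ u i =
      Matrix.toEuclideanCLM (n := Fin d) (𝕜 := ℝ) A₀ (u i) +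
        Matrix.toEuclideanCLM (n := Fin d) (𝕜 := ℝ) A₁ (u (i - 1) + u (i + 1)) := rfl

/-- `(a, b)` is a pair of corresponding eigenvalues of `A₀` and `A₁`: some nonzero vector is an
eigenvector of `A₀` for `a` and of `A₁` for `b`. -/
def IsJointEigenpair {d : ℕ} (A₀ A₁ : Matrix (Fin d) (Fin d) ℝ) (a b : ℝ) : Prop :=
  ∃ v : Fin d → ℝ, v ≠ 0 ∧ A₀.mulVec v = a • v ∧ A₁.mulVec v = b • v

/-- Convolution on `ℓ²(ℤ; ℝ^d)` with the matrix-valued kernel `K` restricted to the centered window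
`{-N, …, N}`: `u ↦ (i ↦ ∑_{|t| ≤ N} K[t] u[i - t])`. -/
def windowConv {d : ℕ} (N : ℕ) (K : ℤ → Matrix (Fin d) (Fin d) ℝ) : GridL2 d →L[ℝ] GridL2 d :=
  ∑ t ∈ Finset.Icc (-(N : ℤ)) (N : ℤ), (gridMatrix (K t)).comp (gridShift d t)

/-- The matrix-valued impulse response of an operator `B` on `ℓ²(ℤ; ℝ^d)`: column `q` of
`impulseResponse B t` is the value at `t` of `B (δ₀ e_q)`. For `B = A⁻¹` this is the Green's kernel
of `A`. -/
def impulseResponse {d : ℕ} (B : GridL2 d →L[ℝ] GridL2 d) (t : ℤ) : Matrix (Fin d) (Fin d) ℝ :=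
  Matrix.of fun p q =>
    (B (lp.single 2 (0 : ℤ) (EuclideanSpace.single q (1 : ℝ))) : GridL2 d) t p

/-- The `n × n` Hilbert matrix `H_{ij} = 1 / (i + j - 1)`, `1 ≤ i, j ≤ n`; the indices of
`Fin n` start at `0`. -/
def hilbertMatrix (n : ℕ) : Matrix (Fin n) (Fin n) ℝ :=
  Matrix.of fun i j => 1 / ((i : ℝ) + (j : ℝ) + 1)

/-- `φ 0, φ 1, …, φ (n-1)` are the USB modes on `n` grid points: orthonormal eigenvectors of the
Hilbert matrix, listed in nonincreasing order of their eigenvalues. -/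
def IsUSB (n : ℕ) (φ : Fin n → EuclideanSpace ℝ (Fin n)) : Prop :=
  Orthonormal ℝ φ ∧ ∃ σ : Fin n → ℝ, Antitone σ ∧
    ∀ l, Matrix.toEuclideanCLM (n := Fin n) (𝕜 := ℝ) (hilbertMatrix n) (φ l) = σ l • φ l

theorem exists_isUSB (n : ℕ) : ∃ φ, IsUSB n φ := by
  have hH : (hilbertMatrix n).IsHermitian := by
    ext i j
    simp [hilbertMatrix, add_comm]
  have hs := Matrix.isSymmetric_toEuclideanLin_iff.mpr hH
  have hn : Module.finrank ℝ (EuclideanSpace ℝ (Fin n)) = n := by simp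
  exact ⟨hs.eigenvectorBasis hn, (hs.eigenvectorBasis hn).orthonormal, hs.eigenvalues hn,
    hs.eigenvalues_antitone hn, fun l => hs.apply_eigenvectorBasis hn l⟩

/-- The kernel spanned by the first `L` modes with matrix coefficients `Θ`, as an even kernel on the
window `{-N, …, N}`: `t ↦ ∑_{l < L} φ_l[|t|] Θ_l` for `|t| ≤ N`, and `0` for `|t| > N`. The modes are
indexed by the `N + 1` offsets `0, …, N`. -/
def usbKernel {d N L : ℕ} (φ : Fin (N + 1) → EuclideanSpace ℝ (Fin (N + 1))) (hL : L ≤ N + 1)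
    (Θ : Fin L → Matrix (Fin d) (Fin d) ℝ) (t : ℤ) : Matrix (Fin d) (Fin d) ℝ :=
  if h : t.natAbs < N + 1 then ∑ l : Fin L, φ (Fin.castLE hL l) ⟨t.natAbs, h⟩ • Θ l else 0

/-- The SFO-parameterized operator with `L` modes on the window `{-N, …, N}`: convolution with the
kernel `usbKernel`. -/
def sfoOperator {d N L : ℕ} (φ : Fin (N + 1) → EuclideanSpace ℝ (Fin (N + 1))) (hL : L ≤ N + 1)
    (Θ : Fin L → Matrix (Fin d) (Fin d) ℝ) : GridL2 d →L[ℝ] GridL2 d :=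
  windowConv N (usbKernel φ hL Θ)

end

/-! A joint eigenbasis of `A₀`, `A₁` reduces the inverse to scalar stencils. For each pair (a, b)
the equation b r² + a r + b = 0 has a root with |r| < 1, so the Green's kernel is a finite sum of
terms r_q^|t| Q_q. Truncating it costs an exponentially small tail, and it remains to approximate
each geometric sequence g = (r^i) by the leading modes.

With p_v(x) = ∑ v_i x^i, the Hilbert form ⟨v, Hv⟩ is ∫₀¹ p_v², and ⟨v, g⟩ = p_v(r). If w is g minus
its projection, then ‖w‖² = ⟨w, g⟩ = p_w(r). Hence it suffices that |p_v(r)| ≤ δ‖v‖ for all v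
orthogonal to the leading modes.

The eigenvalues decay by min-max: about m log n linear conditions force zeros of order m at dyadic
nodes accumulating just outside [0, 1], and Blaschke factors then make p_v of size n 2⁻ᵐ‖v‖ on [0,
1] (`hilbertMatrix_eigenvalue_le`). So orthogonality to the leading modes makes p_v small in L²(0,
1), hence in sup norm there. For r < 0, which the Hilbert form does not see, a two-constants
estimate in the slit disc carries the smallness over (`abs_eval_neg_tan_sq_le`). Taking m of order
log N · log(1/ε) absorbs all powers of N; the number of nodes gives the second logarithm of N. -/

section HilbertModes

/-! ### Polynomials with a given coefficient vector: size bounds -/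

open Polynomial

/-- The polynomial `∑ v_i X^i` with coefficient vector `v`. -/
noncomputable def coeffPoly (n : ℕ) : EuclideanSpace ℝ (Fin n) →ₗ[ℝ] ℝ[X] where
  toFun v := ∑ i : Fin n, monomial (i : ℕ) (v i)
  map_add' v w := by simp [Finset.sum_add_distrib]
  map_smul' c v := by simp [Finset.smul_sum, smul_monomial]

theorem coeffPoly_apply {n : ℕ} (v : EuclideanSpace ℝ (Fin n)) :
    coeffPoly n v = ∑ i : Fin n, monomial (i : ℕ) (v i) := rfl

theorem eval_coeffPoly {n : ℕ} (v : EuclideanSpace ℝ (Fin n)) (x : ℝ) :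
    (coeffPoly n v).eval x = ∑ i : Fin n, v i * x ^ (i : ℕ) := by
  simp [coeffPoly_apply, eval_finsetSum]

/-- The radius is left free because the maximum principle is applied later with R = 1 + 1/n, where
Rⁿ ≤ 3. -/
theorem norm_aeval_coeffPoly_le {n : ℕ} (v : EuclideanSpace ℝ (Fin n)) {R : ℝ} (hR : 1 ≤ R)
    {z : ℂ} (hz : ‖z‖ ≤ R) : ‖aeval z (coeffPoly n v)‖ ≤ n * ‖v‖ * R ^ n := by
  have h : aeval z (coeffPoly n v) = ∑ i : Fin n, (v i : ℂ) * z ^ (i : ℕ) := by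
    simp [coeffPoly_apply, aeval_monomial]
  rw [h]
  refine (norm_sum_le _ _).trans ?_
  have hb : ∀ i ∈ Finset.univ, ‖(v i : ℂ) * z ^ (i : ℕ)‖ ≤ ‖v‖ * R ^ n := by
    intro i _
    rw [norm_mul, norm_pow, Complex.norm_real]
    refine mul_le_mul (PiLp.norm_apply_le v i) ?_ (by positivity) (norm_nonneg _)
    exact (pow_le_pow_left₀ (norm_nonneg _) hz _).trans (pow_le_pow_right₀ hR i.2.le)
  refine (Finset.sum_le_sum hb).trans (le_of_eq ?_)
  simp [mul_assoc]

theorem ofReal_eval_eq_aeval (p : ℝ[X]) (x : ℝ) : ((p.eval x : ℝ) : ℂ) = aeval (x : ℂ) p :=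
  Polynomial.ofReal_eval (K := ℂ) p x

theorem abs_eval_coeffPoly_le {n : ℕ} (v : EuclideanSpace ℝ (Fin n)) {x : ℝ} (hx : |x| ≤ 1) :
    |(coeffPoly n v).eval x| ≤ n * ‖v‖ := by
  have h := norm_aeval_coeffPoly_le v le_rfl (z := (x : ℂ)) (by simpa using hx)
  rw [← ofReal_eval_eq_aeval, Complex.norm_real] at h
  simpa using h

theorem abs_eval_derivative_coeffPoly_le {n : ℕ} (v : EuclideanSpace ℝ (Fin n)) {x : ℝ}
    (hx : |x| ≤ 1) : |(derivative (coeffPoly n v)).eval x| ≤ n ^ 2 * ‖v‖ := by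
  have h : (derivative (coeffPoly n v)).eval x =
      ∑ i : Fin n, v i * (i : ℕ) * x ^ ((i : ℕ) - 1) := by
    simp [coeffPoly_apply, derivative_monomial, eval_finsetSum]
  rw [h]
  refine (Finset.abs_sum_le_sum_abs _ _).trans ?_
  have hb : ∀ i ∈ Finset.univ, |v i * ((i : Fin n) : ℕ) * x ^ ((i : ℕ) - 1)| ≤ ‖v‖ * n := by
    intro i _
    rw [abs_mul, abs_mul, abs_pow, Nat.abs_cast]
    have h1 : |v i| ≤ ‖v‖ := PiLp.norm_apply_le v i
    have h2 : ((i : ℕ) : ℝ) ≤ n := by exact_mod_cast i.2.le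
    have h3 : |x| ^ ((i : ℕ) - 1) ≤ 1 := pow_le_one₀ (abs_nonneg _) hx
    have := mul_le_mul (mul_le_mul h1 h2 (by positivity) (norm_nonneg _)) h3 (by positivity)
      (by positivity)
    simpa using this
  refine (Finset.sum_le_sum hb).trans (le_of_eq ?_)
  simp
  ring

/-! ### Smallness from zeros of high order -/

/-- A polynomial bounded by `M` on the circle of radius `R` and vanishing to order `m` at `a` is at
most `M / 2 ^ m` where the pseudo-hyperbolic distance to `a` is at most `1 / 2`. -/
theorem abs_eval_le_of_pow_dvd {p : ℝ[X]} {a R M x : ℝ} {m : ℕ} (hR : 0 < R)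
    (hx : |x| < R) (hdvd : (X - C a) ^ m ∣ p)
    (hM : ∀ z : ℂ, ‖z‖ = R → ‖aeval z p‖ ≤ M) (hax : 0 < R ^ 2 - a * x)
    (hxa : 2 * (R * |x - a|) ≤ R ^ 2 - a * x) :
    |p.eval x| ≤ M / 2 ^ m := by
  obtain ⟨g, rfl⟩ := hdvd
  -- On the circle R² = z z̄, so (R² - az)/(R(z - a)) is unimodular there. Trading each factor z - a
  -- for R² - az removes the zeros without changing the boundary size up to Rᵐ, and the maximum
  -- principle applies.
  have hcirc : ∀ z : ℂ, ‖z‖ = R → ‖(R : ℂ) ^ 2 - a * z‖ = R * ‖z - a‖ := by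
    intro z hz
    have h1 : (R : ℂ) ^ 2 - a * z = z * (starRingEnd ℂ) (z - a) := by
      have : z * (starRingEnd ℂ) z = (R : ℂ) ^ 2 := by
        rw [Complex.mul_conj, Complex.normSq_eq_norm_sq, hz]; push_cast; ring
      rw [map_sub, mul_sub, this, Complex.conj_ofReal]; ring
    rw [h1, norm_mul, RCLike.norm_conj, hz]
  have hF : ‖((R : ℂ) ^ 2 - a * (x : ℂ)) ^ m * aeval (x : ℂ) g‖ ≤ R ^ m * M := by
    refine Complex.norm_le_of_forall_mem_frontier_norm_le (U := Metric.ball (0 : ℂ) R)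
      (f := fun z : ℂ => ((R : ℂ) ^ 2 - a * z) ^ m * aeval z g) Metric.isBounded_ball ?_ ?_ ?_
    · refine Differentiable.diffContOnCl ?_
      have : Differentiable ℂ fun z : ℂ => aeval z g := g.differentiable_aeval
      fun_prop
    · intro z hz
      rw [frontier_ball _ hR.ne', mem_sphere_zero_iff_norm] at hz
      have h := hM z hz
      simp only [map_mul, map_pow, map_sub, aeval_X, aeval_C, norm_mul, norm_pow] at h ⊢
      rw [hcirc z hz, mul_pow, mul_assoc]
      exact mul_le_mul_of_nonneg_left h (by positivity)
    · rw [closure_ball _ hR.ne', mem_closedBall_zero_iff, Complex.norm_real]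
      exact hx.le
  have hF' : (R ^ 2 - a * x) ^ m * |g.eval x| ≤ R ^ m * M := by
    have e : ((R : ℂ) ^ 2 - a * (x : ℂ)) ^ m * aeval (x : ℂ) g =
        (((R ^ 2 - a * x) ^ m * g.eval x : ℝ) : ℂ) := by
      rw [← ofReal_eval_eq_aeval]; push_cast; ring
    rw [e, Complex.norm_real, Real.norm_eq_abs, abs_mul, abs_pow, abs_of_pos hax] at hF
    exact hF
  have hM0 : 0 ≤ M := (norm_nonneg _).trans (hM (R : ℂ) (by simp [abs_of_pos hR]))
  have hP : 0 < (R ^ 2 - a * x) ^ m := pow_pos hax m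
  rw [le_div_iff₀ (by positivity)]
  refine le_of_mul_le_mul_right ?_ hP
  have h2 := pow_le_pow_left₀ (by positivity) hxa m
  simp only [mul_pow] at h2
  have e2 : |((X - C a) ^ m * g).eval x| = |x - a| ^ m * |g.eval x| := by
    simp [abs_mul, abs_pow]
  rw [e2]
  calc |x - a| ^ m * |g.eval x| * 2 ^ m * (R ^ 2 - a * x) ^ m
      = (2 ^ m * |x - a| ^ m) * ((R ^ 2 - a * x) ^ m * |g.eval x|) := by ring
    _ ≤ (2 ^ m * |x - a| ^ m) * (R ^ m * M) := by gcongr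
    _ = (2 ^ m * (R ^ m * |x - a| ^ m)) * M := by ring
    _ ≤ (R ^ 2 - a * x) ^ m * M := by gcongr
    _ = _ := by ring

/-- The monic polynomial with zeros of order `m` at the points `(1 + 1/n) (1 - 2⁻ʲ)`,
`j ≤ ⌈log₂ (n + 1)⌉`. -/
noncomputable def dyadicNodePoly (n m : ℕ) : ℝ[X] :=
  ∏ j ∈ Finset.range (Nat.clog 2 (n + 1) + 1), (X - C ((1 + 1 / (n : ℝ)) * (1 - (1 / 2) ^ j))) ^ m

theorem dyadicNodePoly_monic (n m : ℕ) : (dyadicNodePoly n m).Monic :=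
  monic_prod_of_monic _ _ fun _ _ => (monic_X_sub_C _).pow m

theorem natDegree_dyadicNodePoly (n m : ℕ) :
    (dyadicNodePoly n m).natDegree = (Nat.clog 2 (n + 1) + 1) * m := by
  rw [dyadicNodePoly, natDegree_prod_of_monic _ _ fun _ _ => (monic_X_sub_C _).pow m]
  simp only [natDegree_pow, natDegree_X_sub_C, mul_one, Finset.sum_const, Finset.card_range,
    smul_eq_mul]

theorem exists_dyadic_le {J : ℕ} {y : ℝ} (hy : (1 / 2 : ℝ) ^ J ≤ y) (hy1 : y ≤ 1) :
    ∃ j ≤ J, (1 / 2 : ℝ) ^ j ≤ y ∧ y ≤ 2 * (1 / 2) ^ j := by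
  classical
  have hex : ∃ j, (1 / 2 : ℝ) ^ j ≤ y := ⟨J, hy⟩
  refine ⟨Nat.find hex, Nat.find_min' hex hy, Nat.find_spec hex, ?_⟩
  rcases h : Nat.find hex with _ | k
  · norm_num; linarith
  · have := Nat.find_min hex (m := k) (by omega)
    rw [pow_succ]; linarith

theorem abs_eval_coeffPoly_le_of_dyadicNodePoly_dvd {n : ℕ} (hn : 0 < n) {m : ℕ}
    {v : EuclideanSpace ℝ (Fin n)} (h : dyadicNodePoly n m ∣ coeffPoly n v) {x : ℝ}
    (hx0 : 0 ≤ x) (hx1 : x ≤ 1) : |(coeffPoly n v).eval x| ≤ 3 * n * ‖v‖ / 2 ^ m := by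
  have hn' : (0 : ℝ) < n := by exact_mod_cast hn
  set R : ℝ := 1 + 1 / n with hRdef
  have hR1 : 1 < R := by rw [hRdef]; have : 0 < 1 / (n : ℝ) := by positivity
                         linarith
  have hR0 : 0 < R := by linarith
  have hRn : R ^ n ≤ 3 := by
    have h1 : R ≤ Real.exp (1 / n) := by
      have := Real.add_one_le_exp (1 / (n : ℝ)); linarith
    have h2 := pow_le_pow_left₀ hR0.le h1 n
    rw [← Real.exp_nat_mul, mul_one_div_cancel hn'.ne'] at h2
    exact h2.trans Real.exp_one_lt_three.le
  have hRinv : 1 / R = 1 - 1 / (n + 1) := by rw [hRdef]; field_simp; ring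
  have hJ : (1 / 2 : ℝ) ^ (Nat.clog 2 (n + 1)) ≤ 1 / (n + 1) := by
    rw [one_div_pow]
    refine one_div_le_one_div_of_le (by positivity) ?_
    exact_mod_cast Nat.le_pow_clog (b := 2) (by norm_num) (n + 1)
  -- In the coordinate x = R(1 - y), points of [0, 1] have 1/(n+1) ≤ y ≤ 1, so dyadic scales down to
  -- 1/(n+1) suffice. This is why only about log n nodes are needed.
  obtain ⟨y, hy⟩ : ∃ y, x = R * (1 - y) := ⟨1 - x / R, by field_simp; ring⟩
  have hyx : 1 - y = x / R := by rw [hy]; field_simp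
  have hy1 : y ≤ 1 := by
    have : 0 ≤ x / R := by positivity
    linarith
  have hyl : 1 / ((n : ℝ) + 1) ≤ y := by
    have : x / R ≤ 1 / R := by gcongr
    linarith
  have hy0 : 0 < y := lt_of_lt_of_le (by positivity) hyl
  obtain ⟨j, hj, hb1, hb2⟩ := exists_dyadic_le (hJ.trans hyl) hy1
  set b : ℝ := (1 / 2) ^ j
  have hb0 : 0 < b := by positivity
  -- The pseudo-hyperbolic distance to the node is (y - b)/(y + b - yb); it is at most 1/2 because y
  -- ≤ 2b and yb ≤ b.
  have hkey : 2 * (y - b) ≤ y + b - y * b := by nlinarith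
  have hpos : 0 < y + b - y * b := by nlinarith
  have hdvd : (X - C (R * (1 - b))) ^ m ∣ coeffPoly n v := by
    refine dvd_trans ?_ h
    exact Finset.dvd_prod_of_mem (fun j => (X - C (R * (1 - (1 / 2) ^ j))) ^ m)
      (Finset.mem_range.2 (Nat.lt_succ_of_le hj))
  have e1 : R ^ 2 - R * (1 - b) * x = R ^ 2 * (y + b - y * b) := by rw [hy]; ring
  have e2 : R * |x - R * (1 - b)| = R ^ 2 * (y - b) := by
    have : x - R * (1 - b) = -(R * (y - b)) := by rw [hy]; ring
    rw [this, abs_neg, abs_of_nonneg (mul_nonneg hR0.le (by linarith))]; ring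
  have := abs_eval_le_of_pow_dvd (M := 3 * n * ‖v‖) hR0
    (by rw [abs_of_nonneg hx0]; linarith) hdvd ?_ (by rw [e1]; positivity) ?_
  · exact this
  · intro z hz
    refine (norm_aeval_coeffPoly_le v hR1.le hz.le).trans ?_
    have : (n : ℝ) * ‖v‖ * R ^ n ≤ n * ‖v‖ * 3 := by gcongr
    linarith
  · rw [e1, e2]
    have := mul_le_mul_of_nonneg_left hkey (sq_nonneg R)
    linarith

/-! ### The Hilbert form as an L² norm on [0, 1] -/

/-- The Hilbert matrix is the Gram matrix of the monomials: with indices from 0, its entry is ∫₀¹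
x^(i+j) dx. -/
theorem inner_hilbertMatrix {n : ℕ} (v : EuclideanSpace ℝ (Fin n)) :
    inner ℝ v (Matrix.toEuclideanCLM (n := Fin n) (𝕜 := ℝ) (hilbertMatrix n) v) =
      ∫ x in (0 : ℝ)..1, (coeffPoly n v).eval x ^ 2 := by
  have h1 : ∀ x : ℝ, (coeffPoly n v).eval x ^ 2 =
      ∑ i : Fin n, ∑ j : Fin n, (v i * v j) * x ^ ((i : ℕ) + (j : ℕ)) := by
    intro x
    rw [eval_coeffPoly, sq, Finset.sum_mul_sum]
    refine Finset.sum_congr rfl fun i _ => Finset.sum_congr rfl fun j _ => ?_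
    rw [pow_add]; ring
  simp_rw [h1]
  rw [intervalIntegral.integral_finsetSum
    (fun i _ => Continuous.intervalIntegrable (by fun_prop) _ _)]
  rw [PiLp.inner_apply]
  refine Finset.sum_congr rfl fun i _ => ?_
  rw [intervalIntegral.integral_finsetSum
    (fun i _ => Continuous.intervalIntegrable (by fun_prop) _ _)]
  simp only [intervalIntegral.integral_const_mul, integral_pow]
  simp [Matrix.mulVec, dotProduct, hilbertMatrix, Finset.sum_mul]
  refine Finset.sum_congr rfl fun j _ => ?_
  ring

/-- On `[0, 1]` the sup norm of a polynomial is controlled by its `L²` norm and the sizes of the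
polynomial and its derivative. -/
theorem abs_eval_pow_three_le {p : ℝ[X]} {D M : ℝ}
    (hD : ∀ y ∈ Set.Icc (0 : ℝ) 1, |(derivative p).eval y| ≤ D)
    (hM : ∀ y ∈ Set.Icc (0 : ℝ) 1, |p.eval y| ≤ M) {x : ℝ} (hx : x ∈ Set.Icc (0 : ℝ) 1) :
    |p.eval x| ^ 3 ≤ (3 * D + M) * ∫ y in (0 : ℝ)..1, p.eval y ^ 2 := by
  set I := ∫ y in (0 : ℝ)..1, p.eval y ^ 2 with hI
  have hcont : Continuous fun y : ℝ => p.eval y ^ 2 := by fun_prop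
  have hD0 : 0 ≤ D := (abs_nonneg _).trans (hD x hx)
  -- The derivative of p³ is 3p²p', at most 3D p² in size, so |p(x)|³ and |p(y)|³ differ by at most
  -- 3D times the integral. Averaging over y finishes.
  have key : ∀ y ∈ Set.Icc (0 : ℝ) 1, |p.eval x| ^ 3 - 3 * D * I ≤ M * p.eval y ^ 2 := by
    intro y hy
    have hint : ∫ s in y..x, (derivative (p ^ 3)).eval s = p.eval x ^ 3 - p.eval y ^ 3 := by
      rw [intervalIntegral.integral_eq_sub_of_hasDerivAt (f := fun s => (p ^ 3).eval s)
        (fun s _ => (p ^ 3).hasDerivAt s) (Continuous.intervalIntegrable (by fun_prop) _ _)]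
      simp
    have hsub : Set.uIoc y x ⊆ Set.Ioc (0 : ℝ) 1 := by
      intro s hs
      rw [Set.mem_uIoc] at hs
      rcases hs with hs | hs
      · exact ⟨hy.1.trans_lt hs.1, hs.2.trans hx.2⟩
      · exact ⟨hx.1.trans_lt hs.1, hs.2.trans hy.2⟩
    have hbound : |∫ s in y..x, (derivative (p ^ 3)).eval s| ≤ 3 * D * I := by
      rw [← Real.norm_eq_abs]
      refine (intervalIntegral.norm_integral_le_integral_norm_uIoc).trans ?_
      have hcI : Continuous fun s : ℝ => 3 * D * p.eval s ^ 2 := by fun_prop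
      have hint1 : MeasureTheory.IntegrableOn (fun s : ℝ => 3 * D * p.eval s ^ 2)
          (Set.Ioc (0 : ℝ) 1) := by
        have := hcI.intervalIntegrable (μ := MeasureTheory.volume) 0 1
        rwa [intervalIntegrable_iff_integrableOn_Ioc_of_le zero_le_one] at this
      have e : 3 * D * I = ∫ s in Set.Ioc (0 : ℝ) 1, 3 * D * p.eval s ^ 2 := by
        rw [hI, ← intervalIntegral.integral_const_mul,
          intervalIntegral.integral_of_le zero_le_one]
      rw [e]
      refine le_trans (MeasureTheory.setIntegral_mono_on
        (g := fun s : ℝ => 3 * D * p.eval s ^ 2) ?_ (hint1.mono_set hsub)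
        measurableSet_uIoc ?_) ?_
      · have hc : Continuous fun s : ℝ => ‖(derivative (p ^ 3)).eval s‖ := by fun_prop
        have := hc.intervalIntegrable (μ := MeasureTheory.volume) y x
        rwa [intervalIntegrable_iff] at this
      · intro s hs
        have hs' := hsub hs
        have h1 := hD s ⟨hs'.1.le, hs'.2⟩
        have e3 : (derivative (p ^ 3)).eval s = 3 * p.eval s ^ 2 * (derivative p).eval s := by
          simp [derivative_pow]
        rw [e3, Real.norm_eq_abs, abs_mul, abs_of_nonneg (by positivity : 0 ≤ 3 * p.eval s ^ 2)]
        have := mul_le_mul_of_nonneg_left h1 (by positivity : 0 ≤ 3 * p.eval s ^ 2)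
        linarith
      · exact MeasureTheory.setIntegral_mono_set hint1
          (Filter.Eventually.of_forall fun s => by positivity)
          (LE.le.eventuallyLE hsub)
    rw [hint] at hbound
    have h4 : |p.eval y| ^ 3 ≤ M * p.eval y ^ 2 := by
      rw [pow_succ, sq_abs, mul_comm]
      exact mul_le_mul_of_nonneg_right (hM y hy) (sq_nonneg _)
    have h5 := abs_sub_abs_le_abs_sub (p.eval x ^ 3) (p.eval y ^ 3)
    rw [abs_pow, abs_pow] at h5
    linarith
  have hmono := intervalIntegral.integral_mono_on (μ := MeasureTheory.volume) zero_le_one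
    (Continuous.intervalIntegrable (by fun_prop) _ _)
    ((hcont.const_mul M).intervalIntegrable _ _) key
  rw [intervalIntegral.integral_const, intervalIntegral.integral_const_mul, ← hI] at hmono
  simp at hmono
  linarith

/-! ### Two-constants estimate for negative arguments -/

theorem norm_sq_cos_sub_norm_sq_sin (z : ℂ) :
    ‖Complex.cos z‖ ^ 2 - ‖Complex.sin z‖ ^ 2 = Real.cos (2 * z.re) := by
  have h : ((‖Complex.cos z‖ ^ 2 - ‖Complex.sin z‖ ^ 2 : ℝ) : ℂ) = Complex.cos (2 * z.re) := by
    have e : (2 * z.re : ℂ) = z + (starRingEnd ℂ) z := by rw [Complex.add_conj]; push_cast; ring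
    rw [e, Complex.cos_add, Complex.cos_conj, Complex.sin_conj, Complex.mul_conj,
      Complex.mul_conj, Complex.normSq_eq_norm_sq, Complex.normSq_eq_norm_sq]
    push_cast; ring
  exact_mod_cast h

/-- On the strip cos(π Re w / 2) ≥ 0, so |sin| ≤ |cos| at πw/4; a zero of cos would force |sin| = 1,
against this. -/
theorem cos_ne_zero_of_re_mem_strip {w : ℂ} (h0 : 0 ≤ w.re) (h1 : w.re ≤ 1) :
    Complex.cos (Real.pi / 4 * w) ≠ 0 ∧ ‖Complex.tan (Real.pi / 4 * w)‖ ≤ 1 := by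
  have hpi := Real.pi_pos
  have hre : ((Real.pi / 4 * w : ℂ)).re = Real.pi / 4 * w.re := by
    have : (Real.pi / 4 * w : ℂ) = ((Real.pi / 4 : ℝ) : ℂ) * w := by push_cast; ring
    rw [this, Complex.re_ofReal_mul]
  have hle : Real.pi / 4 * w.re ≤ Real.pi / 4 := by nlinarith
  have hge : 0 ≤ Real.pi / 4 * w.re := by positivity
  have hcos : 0 ≤ Real.cos (2 * (Real.pi / 4 * w.re)) :=
    Real.cos_nonneg_of_mem_Icc ⟨by linarith, by linarith⟩
  have hd := norm_sq_cos_sub_norm_sq_sin (Real.pi / 4 * w)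
  rw [hre] at hd
  have hne : Complex.cos (Real.pi / 4 * w) ≠ 0 := by
    intro h0
    have hs : Complex.sin (Real.pi / 4 * w) ^ 2 = 1 := by
      have := Complex.sin_sq_add_cos_sq (Real.pi / 4 * w)
      rw [h0] at this; simpa using this
    have hs' : ‖Complex.sin (Real.pi / 4 * w)‖ ^ 2 = 1 := by rw [← norm_pow, hs, norm_one]
    rw [h0, norm_zero, hs'] at hd
    norm_num at hd
    linarith
  refine ⟨hne, ?_⟩
  rw [Complex.tan, norm_div, div_le_one (norm_pos_iff.2 hne)]
  exact le_of_sq_le_sq (by linarith) (norm_nonneg _)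

/-- Two-constants estimate in the disc slit along `[0, 1]`. -/
theorem abs_eval_neg_tan_sq_le {p : ℝ[X]} {s M t : ℝ} (ht0 : 0 ≤ t) (ht1 : t ≤ 1)
    (hs : ∀ x ∈ Set.Icc (0 : ℝ) 1, |p.eval x| ≤ s) (hM : ∀ z : ℂ, ‖z‖ ≤ 1 → ‖aeval z p‖ ≤ M) :
    |p.eval (-Real.tan (Real.pi / 4 * t) ^ 2)| ≤ s ^ (1 - t) * M ^ t := by
  -- The map w ↦ -tan²(πw/4) sends the strip 0 ≤ Re w ≤ 1 into the closed unit disc and the line Re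
  -- w = 0 into [0, 1), where it equals tanh²(π Im w / 4). The three-lines theorem for f is
  -- therefore the required interpolation.
  set f : ℂ → ℂ := fun w => aeval (-Complex.tan (Real.pi / 4 * w) ^ 2) p with hf
  have hball : ∀ w : ℂ, 0 ≤ w.re → w.re ≤ 1 → ‖f w‖ ≤ M := by
    intro w h0 h1
    refine hM _ ?_
    rw [norm_neg, norm_pow]
    exact pow_le_one₀ (norm_nonneg _) (cos_ne_zero_of_re_mem_strip h0 h1).2
  have hdiff : ∀ w : ℂ, 0 ≤ w.re → w.re ≤ 1 → DifferentiableAt ℂ f w := by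
    intro w h0 h1
    have hp : Differentiable ℂ fun z : ℂ => aeval z p := p.differentiable_aeval
    have htan : DifferentiableAt ℂ (fun w : ℂ => -Complex.tan (Real.pi / 4 * w) ^ 2) w := by
      have := (Complex.differentiableAt_tan (x := Real.pi / 4 * w)).2
        (cos_ne_zero_of_re_mem_strip h0 h1).1
      have h2 : DifferentiableAt ℂ (fun w : ℂ => (Real.pi / 4 * w : ℂ)) w := by fun_prop
      exact ((this.comp w h2).pow 2).neg
    exact (hp _).comp w htan
  have hmem : ∀ w ∈ Complex.HadamardThreeLines.verticalClosedStrip 0 1, 0 ≤ w.re ∧ w.re ≤ 1 :=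
    fun w hw => hw
  have h3 := Complex.HadamardThreeLines.norm_le_interp_of_mem_verticalClosedStrip₀₁' f
    (z := (t : ℂ)) (a := s) (b := M) ?_ ?_ ?_ ?_ ?_
  · have e : f t = ((p.eval (-Real.tan (Real.pi / 4 * t) ^ 2) : ℝ) : ℂ) := by
      rw [ofReal_eval_eq_aeval, hf]; push_cast; rfl
    rw [e, Complex.norm_real] at h3
    simpa using h3
  · exact ⟨by simpa using ht0, by simpa using ht1⟩
  · refine ⟨fun w hw => ?_, fun w hw => ?_⟩
    · have hw' : w.re ∈ Set.Ioo (0 : ℝ) 1 := hw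
      exact (hdiff w hw'.1.le hw'.2.le).differentiableWithinAt
    · have hcl : closure (Complex.HadamardThreeLines.verticalStrip 0 1) ⊆
          Complex.HadamardThreeLines.verticalClosedStrip 0 1 :=
        closure_minimal (Set.preimage_mono Set.Ioo_subset_Icc_self)
          (isClosed_Icc.preimage Complex.continuous_re)
      have := hmem w (hcl hw)
      exact (hdiff w this.1 this.2).continuousAt.continuousWithinAt
  · refine ⟨M, ?_⟩
    rintro _ ⟨w, hw, rfl⟩
    exact hball w (hmem w hw).1 (hmem w hw).2
  · intro w hw
    have hw0 : w.re = 0 := hw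
    have ew : (Real.pi / 4 * w : ℂ) = ((Real.pi / 4 * w.im : ℝ) : ℂ) * Complex.I := by
      conv_lhs => rw [← Complex.re_add_im w, hw0]
      push_cast; ring
    have e : f w = ((p.eval (Real.tanh (Real.pi / 4 * w.im) ^ 2) : ℝ) : ℂ) := by
      rw [ofReal_eval_eq_aeval, hf]
      simp only
      rw [ew, Complex.tan_mul_I, mul_pow, Complex.I_sq]
      push_cast; ring_nf
    rw [e, Complex.norm_real]
    refine hs _ ⟨sq_nonneg _, ?_⟩
    rw [Real.tanh_eq_sinh_div_cosh, div_pow, div_le_one (by positivity), Real.cosh_sq]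
    linarith
  · intro w hw
    have hw1 : w.re = 1 := hw
    exact hball w (by rw [hw1]; exact zero_le_one) hw1.le

/-! ### Eigenvalue decay and projection onto the modes -/

theorem exists_orthonormalBasis_eq {n : ℕ} {φ : Fin n → EuclideanSpace ℝ (Fin n)}
    (hφ : Orthonormal ℝ φ) : ∃ b : OrthonormalBasis (Fin n) ℝ (EuclideanSpace ℝ (Fin n)),
      ∀ l, b l = φ l := by
  rcases Nat.eq_zero_or_pos n with rfl | hn
  · exact ⟨EuclideanSpace.basisFun _ _, fun l => l.elim0⟩
  · have : Nonempty (Fin n) := ⟨⟨0, hn⟩⟩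
    have hcard : Fintype.card (Fin n) = Module.finrank ℝ (EuclideanSpace ℝ (Fin n)) := by simp
    have hb := coe_basisOfOrthonormalOfCardEqFinrank hφ hcard
    refine ⟨(basisOfOrthonormalOfCardEqFinrank hφ hcard).toOrthonormalBasis (by rwa [hb]), ?_⟩
    intro l
    simp [hb]

theorem inner_apply_eq_sum_eigenvalues {n : ℕ} {φ : Fin n → EuclideanSpace ℝ (Fin n)}
    (hφ : Orthonormal ℝ φ) {T : EuclideanSpace ℝ (Fin n) →L[ℝ] EuclideanSpace ℝ (Fin n)}
    {σ : Fin n → ℝ} (hσ : ∀ l, T (φ l) = σ l • φ l) (v : EuclideanSpace ℝ (Fin n)) :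
    inner ℝ v (T v) = ∑ l, σ l * inner ℝ (φ l) v ^ 2 := by
  obtain ⟨b, hb⟩ := exists_orthonormalBasis_eq hφ
  have h : T v = ∑ l, (inner ℝ (φ l) v * σ l) • φ l := by
    conv_lhs => rw [← b.sum_repr' v]
    simp only [map_sum, map_smul, hb, hσ, smul_smul]
  rw [h, inner_sum]
  refine Finset.sum_congr rfl fun l _ => ?_
  rw [inner_smul_right, real_inner_comm]
  ring

theorem norm_sq_eq_sum_inner_sq {n : ℕ} {φ : Fin n → EuclideanSpace ℝ (Fin n)}
    (hφ : Orthonormal ℝ φ) (v : EuclideanSpace ℝ (Fin n)) :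
    ‖v‖ ^ 2 = ∑ l, inner ℝ (φ l) v ^ 2 := by
  obtain ⟨b, hb⟩ := exists_orthonormalBasis_eq hφ
  rw [← b.sum_sq_inner_right]
  simp [hb]

/-- The eigenvalues of the Hilbert matrix decay exponentially in `l / log n`. -/
theorem hilbertMatrix_eigenvalue_le {n : ℕ} {φ : Fin n → EuclideanSpace ℝ (Fin n)}
    (hφ : Orthonormal ℝ φ) {σ : Fin n → ℝ} (hσ : Antitone σ)
    (hH : ∀ l, Matrix.toEuclideanCLM (n := Fin n) (𝕜 := ℝ) (hilbertMatrix n) (φ l) = σ l • φ l)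
    {m : ℕ} {L : Fin n} (hL : (Nat.clog 2 (n + 1) + 1) * m ≤ L) :
    σ L ≤ (3 * n / 2 ^ m) ^ 2 := by
  have hn : 0 < n := L.pos
  set Q := dyadicNodePoly n m
  let T₁ : EuclideanSpace ℝ (Fin n) →ₗ[ℝ] (Finset.Ioi L → ℝ) :=
    LinearMap.pi fun l => (innerSL ℝ (φ l)).toLinearMap
  let T₂ : EuclideanSpace ℝ (Fin n) →ₗ[ℝ] (Fin ((Nat.clog 2 (n + 1) + 1) * m) → ℝ) :=
    LinearMap.pi fun i => (lcoeff ℝ (i : ℕ)) ∘ₗ (modByMonicHom Q) ∘ₗ coeffPoly n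
  -- Min-max by dimension count: n - 1 - L conditions place w in the span of the modes 0, …, L, and
  -- at most L more make Q divide its polynomial. The total is below n, so some w ≠ 0 satisfies all
  -- of them.
  have hker : LinearMap.ker (T₁.prod T₂) ≠ ⊥ := by
    apply LinearMap.ker_ne_bot_of_finrank_lt
    rw [Module.finrank_prod, Module.finrank_fintype_fun_eq_card, Module.finrank_fintype_fun_eq_card,
      finrank_euclideanSpace, Fintype.card_coe, Fin.card_Ioi, Fintype.card_fin, Fintype.card_fin]
    have := L.2
    omega
  obtain ⟨w, hw, hw0⟩ := (Submodule.ne_bot_iff _).1 hker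
  replace hw : T₁ w = 0 ∧ T₂ w = 0 := ⟨congrArg Prod.fst hw, congrArg Prod.snd hw⟩
  have hw1 : ∀ l, L < l → inner ℝ (φ l) w = 0 := by
    intro l hl
    exact congrFun hw.1 ⟨l, Finset.mem_Ioi.2 hl⟩
  have hw2 : Q ∣ coeffPoly n w := by
    rw [← modByMonic_eq_zero_iff_dvd (dyadicNodePoly_monic n m)]
    ext i
    rw [coeff_zero]
    by_cases hi : i < (Nat.clog 2 (n + 1) + 1) * m
    · exact congrFun hw.2 ⟨i, hi⟩
    -- Q = 1 when m = 0; the strict degree bound on the remainder fails there.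
    · rcases eq_or_ne (dyadicNodePoly n m) 1 with h1 | h1
      · rw [h1, modByMonic_one, coeff_zero]
      · refine coeff_eq_zero_of_natDegree_lt ?_
        have := natDegree_modByMonic_lt (coeffPoly n w) (dyadicNodePoly_monic n m) h1
        rw [natDegree_dyadicNodePoly] at this
        omega
  have hwpos : 0 < ‖w‖ ^ 2 := by have := norm_pos_iff.2 hw0; positivity
  have hlow : σ L * ‖w‖ ^ 2 ≤ ∫ x in (0 : ℝ)..1, (coeffPoly n w).eval x ^ 2 := by
    rw [← inner_hilbertMatrix, inner_apply_eq_sum_eigenvalues hφ hH, norm_sq_eq_sum_inner_sq hφ,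
      Finset.mul_sum]
    refine Finset.sum_le_sum fun l _ => ?_
    rcases le_or_gt l L with h | h
    · exact mul_le_mul_of_nonneg_right (hσ h) (sq_nonneg _)
    · rw [hw1 l h]; simp
  have hup : ∫ x in (0 : ℝ)..1, (coeffPoly n w).eval x ^ 2 ≤ (3 * n * ‖w‖ / 2 ^ m) ^ 2 := by
    have := intervalIntegral.integral_mono_on (μ := MeasureTheory.volume) zero_le_one
      (f := fun x => (coeffPoly n w).eval x ^ 2) (g := fun _ => (3 * n * ‖w‖ / 2 ^ m) ^ 2)
      (Continuous.intervalIntegrable (by fun_prop) _ _)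
      (Continuous.intervalIntegrable (by fun_prop) _ _) (fun x hx => by
        rw [← sq_abs]
        exact pow_le_pow_left₀ (abs_nonneg _)
          (abs_eval_coeffPoly_le_of_dyadicNodePoly_dvd hn hw2 hx.1 hx.2) 2)
    simpa using this
  have e : (3 * n * ‖w‖ / 2 ^ m) ^ 2 = (3 * n / 2 ^ m) ^ 2 * ‖w‖ ^ 2 := by ring
  rw [e] at hup
  exact le_of_mul_le_mul_right (hlow.trans hup) hwpos

/-- Only eigenvalues from index L on contribute to the Hilbert form of v, so ∫ p_v² is small, and
the cubic inequality turns this into a sup bound. If L ≥ n, then v = 0. -/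
theorem abs_eval_coeffPoly_le_of_orthogonal {n : ℕ} (hn : 0 < n)
    {φ : Fin n → EuclideanSpace ℝ (Fin n)} (hφ : IsUSB n φ) {m L : ℕ}
    (hL : min n ((Nat.clog 2 (n + 1) + 1) * m) ≤ L) {v : EuclideanSpace ℝ (Fin n)}
    (hv : ∀ l : Fin n, (l : ℕ) < L → inner ℝ (φ l) v = 0) {x : ℝ} (hx : x ∈ Set.Icc (0 : ℝ) 1) :
    |(coeffPoly n v).eval x| ≤ 4 * n ^ 2 * (2 / 3) ^ m * ‖v‖ := by
  obtain ⟨hφ, σ, hσ, hH⟩ := hφ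
  have hn1 : (1 : ℝ) ≤ n := by exact_mod_cast hn
  rcases le_or_gt n L with hnL | hLn
  · have h0 : ‖v‖ ^ 2 = 0 := by
      rw [norm_sq_eq_sum_inner_sq hφ]
      exact Finset.sum_eq_zero fun l _ => by rw [hv l (l.2.trans_le hnL)]; simp
    have h0' : v = 0 := by simpa using h0
    simp [h0']
  have hK : (Nat.clog 2 (n + 1) + 1) * m ≤ L := by omega
  have hσL := hilbertMatrix_eigenvalue_le hφ hσ hH (m := m) (L := ⟨L, hLn⟩) hK
  have hint : ∫ y in (0 : ℝ)..1, (coeffPoly n v).eval y ^ 2 ≤ (3 * n / 2 ^ m) ^ 2 * ‖v‖ ^ 2 := by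
    rw [← inner_hilbertMatrix, inner_apply_eq_sum_eigenvalues hφ hH, norm_sq_eq_sum_inner_sq hφ,
      Finset.mul_sum]
    refine Finset.sum_le_sum fun l _ => ?_
    rcases lt_or_ge (l : ℕ) L with h | h
    · rw [hv l h]; simp
    · exact mul_le_mul_of_nonneg_right ((hσ (show (⟨L, hLn⟩ : Fin n) ≤ l from h)).trans hσL)
        (sq_nonneg _)
  have hcube := abs_eval_pow_three_le (p := coeffPoly n v) (D := n ^ 2 * ‖v‖) (M := n * ‖v‖)
    (fun y hy => abs_eval_derivative_coeffPoly_le v (abs_le.2 ⟨by linarith [hy.1], hy.2⟩))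
    (fun y hy => abs_eval_coeffPoly_le v (abs_le.2 ⟨by linarith [hy.1], hy.2⟩)) hx
  refine le_of_pow_le_pow_left₀ (n := 3) (by norm_num) (by positivity) (hcube.trans ?_)
  have h1 : 3 * (n ^ 2 * ‖v‖) + n * ‖v‖ ≤ 4 * n ^ 2 * ‖v‖ := by
    have : (n : ℝ) * ‖v‖ ≤ n ^ 2 * ‖v‖ := by
      refine mul_le_mul_of_nonneg_right ?_ (norm_nonneg _)
      nlinarith
    linarith
  -- The loss from 1/4 to 8/27 = (2/3)³ makes the cube root rational.
  have h2 : ((1 : ℝ) / 4) ^ m ≤ (8 / 27) ^ m := pow_le_pow_left₀ (by norm_num) (by norm_num) m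
  have h3 : (n : ℝ) ^ 4 ≤ n ^ 6 := pow_le_pow_right₀ hn1 (by norm_num)
  calc (3 * (n ^ 2 * ‖v‖) + n * ‖v‖) * ∫ y in (0 : ℝ)..1, (coeffPoly n v).eval y ^ 2
      ≤ (4 * n ^ 2 * ‖v‖) * ((3 * n / 2 ^ m) ^ 2 * ‖v‖ ^ 2) := by
        refine mul_le_mul h1 hint ?_ (by positivity)
        exact intervalIntegral.integral_nonneg zero_le_one fun _ _ => sq_nonneg _
    _ = 36 * n ^ 4 * ‖v‖ ^ 3 * (1 / 4) ^ m := by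
        have : ((1 : ℝ) / 4) ^ m = 1 / (2 ^ m) ^ 2 := by
          rw [← pow_mul, mul_comm m 2, pow_mul, ← one_div_pow]; norm_num
        rw [this]; ring
    _ ≤ 64 * n ^ 6 * ‖v‖ ^ 3 * (8 / 27) ^ m := by gcongr; norm_num
    _ = (4 * n ^ 2 * (2 / 3) ^ m * ‖v‖) ^ 3 := by
        have : ((8 : ℝ) / 27) ^ m = ((2 / 3) ^ m) ^ 3 := by
          rw [← pow_mul, mul_comm m 3, pow_mul]; norm_num
        rw [this]; ring

/-- For a fixed `r ∈ (-1, 1)` the values at `r` of polynomials orthogonal to the leading modes decay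
exponentially. -/
theorem exists_abs_eval_coeffPoly_le_exp {r : ℝ} (hr : |r| < 1) :
    ∃ c : ℝ, 0 < c ∧ ∀ (n : ℕ), 0 < n → ∀ (φ : Fin n → EuclideanSpace ℝ (Fin n)), IsUSB n φ →
      ∀ m L : ℕ, min n ((Nat.clog 2 (n + 1) + 1) * m) ≤ L → ∀ v : EuclideanSpace ℝ (Fin n),
        (∀ l : Fin n, (l : ℕ) < L → inner ℝ (φ l) v = 0) →
          |(coeffPoly n v).eval r| ≤ 4 * n ^ 2 * Real.exp (-c * m) * ‖v‖ := by
  have hlog : 0 < Real.log (3 / 2) := Real.log_pos (by norm_num)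
  have hexp : ∀ u : ℝ, ∀ m : ℕ,
      (((2 : ℝ) / 3) ^ m) ^ u = Real.exp (-(u * Real.log (3 / 2)) * m) := by
    intro u m
    rw [Real.rpow_def_of_pos (by positivity), Real.log_pow,
      show (2 : ℝ) / 3 = (3 / 2)⁻¹ by norm_num, Real.log_inv]
    ring_nf
  rw [abs_lt] at hr
  rcases le_or_gt 0 r with h0 | h0
  · refine ⟨Real.log (3 / 2), hlog, fun n hn φ hφ m L hL v hv => ?_⟩
    have := hexp 1 m
    rw [Real.rpow_one, one_mul] at this
    rw [← this]
    exact abs_eval_coeffPoly_le_of_orthogonal hn hφ hL hv ⟨h0, hr.2.le⟩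
  · have hpi := Real.pi_pos
    -- As t runs over [0, 1), -tan²(πt/4) covers (-1, 0]. Interpolation keeps the fraction 1 - t of
    -- the decay rate, which stays positive since r > -1.
    obtain ⟨t, ht0, ht1, htr⟩ : ∃ t : ℝ, 0 ≤ t ∧ t < 1 ∧ -Real.tan (Real.pi / 4 * t) ^ 2 = r := by
      refine ⟨Real.arctan (√(-r)) / (Real.pi / 4), ?_, ?_, ?_⟩
      · exact div_nonneg (Real.arctan_nonneg.2 (Real.sqrt_nonneg _)) (by positivity)
      · rw [div_lt_one (by positivity), ← Real.arctan_one]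
        refine Real.arctan_strictMono ?_
        rw [Real.sqrt_lt' one_pos]
        linarith
      · rw [mul_div_cancel₀ _ (by positivity), Real.tan_arctan, Real.sq_sqrt (by linarith)]
        ring
    refine ⟨(1 - t) * Real.log (3 / 2), mul_pos (by linarith) hlog,
      fun n hn φ hφ m L hL v hv => ?_⟩
    have hn1 : (1 : ℝ) ≤ n := by exact_mod_cast hn
    have h2 := abs_eval_neg_tan_sq_le (p := coeffPoly n v) (M := n * ‖v‖) ht0 ht1.le
      (fun x hx => abs_eval_coeffPoly_le_of_orthogonal hn hφ hL hv hx) (fun z hz => by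
        have := norm_aeval_coeffPoly_le v le_rfl hz
        simpa using this)
    rw [htr] at h2
    refine h2.trans ?_
    have hM : (n : ℝ) * ‖v‖ ≤ 4 * n ^ 2 * ‖v‖ := by
      refine mul_le_mul_of_nonneg_right ?_ (norm_nonneg _)
      nlinarith
    calc (4 * (n : ℝ) ^ 2 * (2 / 3) ^ m * ‖v‖) ^ (1 - t) * (n * ‖v‖) ^ t
        ≤ (4 * (n : ℝ) ^ 2 * (2 / 3) ^ m * ‖v‖) ^ (1 - t) * (4 * n ^ 2 * ‖v‖) ^ t := by gcongr
      _ = (4 * (n : ℝ) ^ 2 * ‖v‖) ^ (1 - t) * (4 * n ^ 2 * ‖v‖) ^ t * ((2 / 3) ^ m) ^ (1 - t) := by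
          rw [show 4 * (n : ℝ) ^ 2 * (2 / 3) ^ m * ‖v‖ = 4 * (n : ℝ) ^ 2 * ‖v‖ * (2 / 3) ^ m by ring,
            Real.mul_rpow (by positivity) (by positivity)]
          ring
      _ = (4 * (n : ℝ) ^ 2 * ‖v‖) * ((2 / 3) ^ m) ^ (1 - t) := by
          rw [← Real.rpow_add_of_nonneg (by positivity) (by linarith) ht0]
          simp
      _ = _ := by rw [hexp]; ring

/-- Projection of a geometric sequence onto the leading modes. -/
theorem exists_abs_pow_sub_sum_modes_le {r : ℝ} (hr : |r| < 1) :
    ∃ c : ℝ, 0 < c ∧ ∀ (n : ℕ), 0 < n → ∀ (φ : Fin n → EuclideanSpace ℝ (Fin n)), IsUSB n φ →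
      ∀ (m L : ℕ) (hLn : L ≤ n), min n ((Nat.clog 2 (n + 1) + 1) * m) ≤ L →
        ∃ θ : Fin L → ℝ, ∀ i : Fin n,
          |r ^ (i : ℕ) - ∑ l : Fin L, φ (Fin.castLE hLn l) i * θ l| ≤
            4 * n ^ 2 * Real.exp (-c * m) := by
  obtain ⟨c, hc, h⟩ := exists_abs_eval_coeffPoly_le_exp hr
  refine ⟨c, hc, fun n hn φ hφ m L hLn hL => ?_⟩
  set g : EuclideanSpace ℝ (Fin n) := WithLp.toLp 2 fun i => r ^ (i : ℕ) with hg
  set w : EuclideanSpace ℝ (Fin n) :=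
    g - ∑ l : Fin L, inner ℝ (φ (Fin.castLE hLn l)) g • φ (Fin.castLE hLn l) with hw
  have hinj : Function.Injective (Fin.castLE hLn) := Fin.castLE_injective hLn
  have horth : ∀ l : Fin L, inner ℝ (φ (Fin.castLE hLn l)) w = 0 := by
    intro l
    have := (hφ.1.comp _ hinj).inner_right_fintype
      (fun l => inner ℝ (φ (Fin.castLE hLn l)) g) l
    rw [hw, inner_sub_right]
    exact sub_eq_zero.2 this.symm
  have hvw : ∀ l : Fin n, (l : ℕ) < L → inner ℝ (φ l) w = 0 := fun l hl => horth ⟨l, hl⟩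
  have h1 := h n hn φ hφ m L hL w hvw
  -- The residual is orthogonal to the projection, so p_w(r) = ⟨w, g⟩ = ‖w‖². A bound of p_w(r) by
  -- δ‖w‖ thus becomes ‖w‖ ≤ δ.
  have h2 : (coeffPoly n w).eval r = ‖w‖ ^ 2 := by
    have e1 : (coeffPoly n w).eval r = inner ℝ w g := by
      rw [eval_coeffPoly, PiLp.inner_apply]
      simp [hg, mul_comm]
    have e2 : inner ℝ w w = inner ℝ w g := by
      conv_lhs => enter [3]; rw [hw]
      rw [inner_sub_right, inner_sum, Finset.sum_eq_zero, sub_zero]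
      intro l _
      rw [inner_smul_right, real_inner_comm _ w, horth l, mul_zero]
    rw [e1, ← e2, real_inner_self_eq_norm_sq]
  rw [h2, abs_of_nonneg (sq_nonneg _), sq] at h1
  have h3 : ‖w‖ ≤ 4 * n ^ 2 * Real.exp (-c * m) := by
    rcases (norm_nonneg w).eq_or_lt with h0 | h0
    · rw [← h0]; positivity
    · exact le_of_mul_le_mul_right h1 h0
  refine ⟨fun l => inner ℝ (φ (Fin.castLE hLn l)) g, fun i => ?_⟩
  have h4 : |w i| ≤ ‖w‖ := PiLp.norm_apply_le w i
  have h5 : w i = r ^ (i : ℕ) -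
      ∑ l : Fin L, φ (Fin.castLE hLn l) i * inner ℝ (φ (Fin.castLE hLn l)) g := by
    rw [hw, PiLp.sub_apply, WithLp.ofLp_sum, Finset.sum_apply]
    simp [hg, mul_comm]
  rw [← h5]
  exact h4.trans h3

end HilbertModes

/-! ### Convolution operators with summable matrix kernels -/

section KernelOperators

theorem gridL2_clm_ext {d : ℕ} {S T : GridL2 d →L[ℝ] GridL2 d} (h : ∀ u i, S u i = T u i) :
    S = T :=
  ContinuousLinearMap.ext fun u => lp.ext (funext fun i => h u i)

theorem norm_gridShift_le {d : ℕ} (s : ℤ) : ‖gridShift d s‖ ≤ 1 :=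
  LinearMap.mkContinuous_norm_le _ zero_le_one _

/-- The operator norm of a matrix acting on Euclidean space. -/
noncomputable def matOpNorm {d : ℕ} (B : Matrix (Fin d) (Fin d) ℝ) : ℝ :=
  ‖Matrix.toEuclideanCLM (n := Fin d) (𝕜 := ℝ) B‖

theorem matOpNorm_nonneg {d : ℕ} (B : Matrix (Fin d) (Fin d) ℝ) : 0 ≤ matOpNorm B :=
  norm_nonneg _

theorem matOpNorm_smul {d : ℕ} (c : ℝ) (B : Matrix (Fin d) (Fin d) ℝ) :
    matOpNorm (c • B) = |c| * matOpNorm B := by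
  rw [matOpNorm, map_smul, norm_smul, Real.norm_eq_abs, matOpNorm]

theorem matOpNorm_sum_le {d : ℕ} {ι : Type*} (s : Finset ι)
    (B : ι → Matrix (Fin d) (Fin d) ℝ) : matOpNorm (∑ i ∈ s, B i) ≤ ∑ i ∈ s, matOpNorm (B i) := by
  rw [matOpNorm, map_sum]
  exact norm_sum_le _ _

theorem norm_gridMatrix_le {d : ℕ} (B : Matrix (Fin d) (Fin d) ℝ) :
    ‖gridMatrix B‖ ≤ matOpNorm B :=
  lp.norm_mapCLM_le 2 _ (norm_nonneg _) _

theorem gridMatrix_add {d : ℕ} (B C : Matrix (Fin d) (Fin d) ℝ) :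
    gridMatrix (B + C) = gridMatrix B + gridMatrix C :=
  gridL2_clm_ext fun u i => by
    simp only [gridMatrix_apply, map_add, add_apply, lp.coeFn_add, Pi.add_apply]

theorem gridMatrix_sub {d : ℕ} (B C : Matrix (Fin d) (Fin d) ℝ) :
    gridMatrix (B - C) = gridMatrix B - gridMatrix C :=
  gridL2_clm_ext fun u i => by
    simp only [gridMatrix_apply, map_sub, sub_apply, lp.coeFn_sub, Pi.sub_apply]

theorem gridMatrix_mul {d : ℕ} (B C : Matrix (Fin d) (Fin d) ℝ) :
    gridMatrix (B * C) = gridMatrix B * gridMatrix C :=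
  gridL2_clm_ext fun u i => by
    rw [gridMatrix_apply, map_mul, mul_apply_eq_comp, mul_apply_eq_comp,
      gridMatrix_apply, gridMatrix_apply]

theorem gridMatrix_one {d : ℕ} : gridMatrix (1 : Matrix (Fin d) (Fin d) ℝ) = 1 :=
  gridL2_clm_ext fun u i => by
    rw [gridMatrix_apply, map_one, one_apply_eq_self, one_apply_eq_self]

theorem gridMatrix_zero {d : ℕ} : gridMatrix (0 : Matrix (Fin d) (Fin d) ℝ) = 0 :=
  gridL2_clm_ext fun u i => by
    rw [gridMatrix_apply, map_zero]; rfl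

theorem gridShift_zero {d : ℕ} : gridShift d 0 = 1 :=
  gridL2_clm_ext fun u i => by
    rw [gridShift_apply, sub_zero, one_apply_eq_self]

theorem gridShift_mul {d : ℕ} (s t : ℤ) :
    gridShift d s * gridShift d t = gridShift d (s + t) :=
  gridL2_clm_ext fun u i => by
    rw [mul_apply_eq_comp, gridShift_apply, gridShift_apply, gridShift_apply, sub_sub]

theorem gridShift_commute_gridMatrix {d : ℕ} (s : ℤ) (B : Matrix (Fin d) (Fin d) ℝ) :
    Commute (gridShift d s) (gridMatrix B) :=
  gridL2_clm_ext fun u i => by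
    rw [mul_apply_eq_comp, mul_apply_eq_comp, gridShift_apply,
      gridMatrix_apply, gridMatrix_apply, gridShift_apply]

theorem norm_gridMatrix_mul_gridShift_le {d : ℕ} (B : Matrix (Fin d) (Fin d) ℝ) (t : ℤ) :
    ‖gridMatrix B * gridShift d t‖ ≤ matOpNorm B := by
  refine (norm_mul_le _ _).trans ?_
  have := mul_le_mul (norm_gridMatrix_le B) (norm_gridShift_le (d := d) t) (norm_nonneg _)
    (matOpNorm_nonneg B)
  rwa [mul_one] at this

/-- Convolution on `ℓ²(ℤ; ℝ^d)` with a matrix-valued kernel. -/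
noncomputable def kernelConv {d : ℕ} (K : ℤ → Matrix (Fin d) (Fin d) ℝ) :
    GridL2 d →L[ℝ] GridL2 d :=
  ∑' t : ℤ, gridMatrix (K t) * gridShift d t

theorem hasSum_kernelConv {d : ℕ} {K : ℤ → Matrix (Fin d) (Fin d) ℝ}
    (hK : Summable fun t => matOpNorm (K t)) :
    HasSum (fun t : ℤ => gridMatrix (K t) * gridShift d t) (kernelConv K) :=
  (Summable.of_norm_bounded hK fun t => norm_gridMatrix_mul_gridShift_le _ t).hasSum

/-- This identifies the Green's kernel with the explicit kernel: evaluation at a fixed input and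
grid point is continuous on operators, and on a delta input only one term of the series survives. -/
theorem impulseResponse_kernelConv {d : ℕ} {K : ℤ → Matrix (Fin d) (Fin d) ℝ}
    (hK : Summable fun t => matOpNorm (K t)) : impulseResponse (kernelConv K) = K := by
  funext t
  ext p q
  set u : GridL2 d := lp.single 2 (0 : ℤ) (EuclideanSpace.single q (1 : ℝ))
  let ev : (GridL2 d →L[ℝ] GridL2 d) →L[ℝ] EuclideanSpace ℝ (Fin d) :=
    (lp.evalCLM ℝ (fun _ : ℤ => EuclideanSpace ℝ (Fin d)) 2 t).comp
      (ContinuousLinearMap.apply ℝ (GridL2 d) u)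
  have hev : ∀ T, ev T = T u t := fun T => rfl
  have h1 : HasSum (fun s : ℤ => ev (gridMatrix (K s) * gridShift d s)) (ev (kernelConv K)) :=
    (hasSum_kernelConv hK).mapL ev
  have h2 : ∀ s, ev (gridMatrix (K s) * gridShift d s) =
      Matrix.toEuclideanCLM (n := Fin d) (𝕜 := ℝ) (K s) (u (t - s)) := by
    intro s
    rw [hev, mul_apply_eq_comp, gridMatrix_apply, gridShift_apply]
  have h3 : HasSum (fun s : ℤ => ev (gridMatrix (K s) * gridShift d s))
      (Matrix.toEuclideanCLM (n := Fin d) (𝕜 := ℝ) (K t) (EuclideanSpace.single q (1 : ℝ))) := by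
    have h := hasSum_single (f := fun s : ℤ => ev (gridMatrix (K s) * gridShift d s)) t ?_
    · convert h using 1
      rw [h2, sub_self, lp.single_apply_self]
    · intro s hs
      rw [h2, lp.single_apply_ne _ _ _ (sub_ne_zero.2 (Ne.symm hs)), map_zero]
  have h4 := h1.unique h3
  rw [hev] at h4
  rw [impulseResponse, Matrix.of_apply]
  change (kernelConv K u) t p = _
  rw [h4]
  simp

/-- The tail of an exponentially decaying kernel. -/
theorem norm_kernelConv_sub_windowConv_le {d : ℕ} {K : ℤ → Matrix (Fin d) (Fin d) ℝ} {B κ : ℝ}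
    (hκ : 0 < κ) (hB : 0 ≤ B)
    (hs : Summable fun t : ℤ => Real.exp (-κ * t.natAbs))
    (hK : ∀ t, matOpNorm (K t) ≤ B * Real.exp (-(2 * κ) * t.natAbs)) (N : ℕ) :
    ‖kernelConv K - windowConv N K‖ ≤
      B * Real.exp (-κ * N) * ∑' t : ℤ, Real.exp (-κ * t.natAbs) := by
  have hle : ∀ t, matOpNorm (K t) ≤ B * Real.exp (-κ * t.natAbs) := fun t => by
    refine (hK t).trans (mul_le_mul_of_nonneg_left (Real.exp_le_exp.2 ?_) hB)
    have : (0 : ℝ) ≤ t.natAbs := by positivity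
    nlinarith
  have h1 := hasSum_kernelConv
    (Summable.of_nonneg_of_le (fun t => matOpNorm_nonneg (K t)) hle (hs.mul_left B))
  set s := Finset.Icc (-(N : ℤ)) N with hsdef
  have h2 : HasSum (fun t : ℤ => if t ∈ s then gridMatrix (K t) * gridShift d t else 0)
      (windowConv N K) := by
    have := hasSum_sum_of_ne_finset_zero (s := s) (L := SummationFilter.unconditional ℤ)
      (f := fun t : ℤ => if t ∈ s then gridMatrix (K t) * gridShift d t else 0)
      (fun t ht => if_neg ht)
    rw [Finset.sum_congr rfl (fun t ht => if_pos ht)] at this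
    exact this
  have h3 := h1.sub h2
  rw [← h3.tsum_eq]
  refine tsum_of_norm_bounded (hs.hasSum.mul_left (B * Real.exp (-κ * N))) fun t => ?_
  by_cases ht : t ∈ s
  · rw [if_pos ht, sub_self, norm_zero]; positivity
  · rw [if_neg ht, sub_zero]
    refine (norm_gridMatrix_mul_gridShift_le _ t).trans ((hK t).trans ?_)
    rw [mul_assoc, ← Real.exp_add]
    refine mul_le_mul_of_nonneg_left (Real.exp_le_exp.2 ?_) hB
    -- Outside the window |t| ≥ N, so half of the rate 2κ pays for exp(-κN) and the other half keeps
    -- the series summable.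
    have hN : (N : ℝ) ≤ t.natAbs := by
      rw [hsdef, Finset.mem_Icc] at ht
      have : N ≤ t.natAbs := by omega
      exact_mod_cast this
    nlinarith

theorem norm_windowConv_sub_le {d N : ℕ} {K K' : ℤ → Matrix (Fin d) (Fin d) ℝ} {δ : ℝ}
    (h : ∀ t : ℤ, t.natAbs ≤ N → matOpNorm (K t - K' t) ≤ δ) :
    ‖windowConv N K - windowConv N K'‖ ≤ (2 * N + 1) * δ := by
  rw [windowConv, windowConv, ← Finset.sum_sub_distrib]
  have hb : ∀ t ∈ Finset.Icc (-(N : ℤ)) N,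
      ‖(gridMatrix (K t)).comp (gridShift d t) - (gridMatrix (K' t)).comp (gridShift d t)‖ ≤ δ := by
    intro t ht
    have e : (gridMatrix (K t)).comp (gridShift d t) - (gridMatrix (K' t)).comp (gridShift d t) =
        gridMatrix (K t - K' t) * gridShift d t := by
      rw [gridMatrix_sub, sub_mul]; rfl
    rw [e]
    rw [Finset.mem_Icc] at ht
    exact (norm_gridMatrix_mul_gridShift_le _ t).trans (h t (by omega))
  refine (norm_sum_le _ _).trans ((Finset.sum_le_card_nsmul _ _ _ hb).trans (le_of_eq ?_))
  have hc : (Finset.Icc (-(N : ℤ)) N).card = 2 * N + 1 := by rw [Int.card_Icc]; omega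
  rw [hc, nsmul_eq_mul]
  push_cast
  ring

theorem stencilOperator_eq {d : ℕ} (A₀ A₁ : Matrix (Fin d) (Fin d) ℝ) :
    stencilOperator A₀ A₁ = gridMatrix A₀ + gridMatrix A₁ * (gridShift d 1 + gridShift d (-1)) :=
  rfl

theorem stencilOperator_mul_kernelConv {d : ℕ} {A₀ A₁ : Matrix (Fin d) (Fin d) ℝ}
    {K : ℤ → Matrix (Fin d) (Fin d) ℝ} (hK : Summable fun t => matOpNorm (K t))
    (h : ∀ t, A₀ * K t + A₁ * (K (t - 1) + K (t + 1)) = if t = 0 then 1 else 0) :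
    stencilOperator A₀ A₁ * kernelConv K = 1 := by
  have hc := hasSum_kernelConv hK
  have h0 := hc.mul_left (gridMatrix A₀)
  have hs : ∀ s : ℤ, HasSum (fun t : ℤ => gridMatrix (A₁ * K (t - s)) * gridShift d t)
      (gridMatrix A₁ * gridShift d s * kernelConv K) := by
    intro s
    have h1 := hc.mul_left (gridMatrix A₁ * gridShift d s)
    -- Reindexing by t - s moves the shift in the stencil onto the kernel.
    rw [← (Equiv.subRight s).hasSum_iff] at h1
    refine (congrArg (fun f => HasSum f _) (funext fun t => ?_)).mpr h1
    rw [Function.comp_apply, Equiv.subRight_apply, mul_assoc (gridMatrix A₁),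
      ← mul_assoc (gridShift d s), (gridShift_commute_gridMatrix s _).eq, mul_assoc (gridMatrix (K (t - s))), gridShift_mul,
      gridMatrix_mul, mul_assoc, add_sub_cancel]
  have hsum := (h0.add (hs 1)).add (hs (-1))
  have e : gridMatrix A₀ * kernelConv K + gridMatrix A₁ * gridShift d 1 * kernelConv K +
      gridMatrix A₁ * gridShift d (-1) * kernelConv K = stencilOperator A₀ A₁ * kernelConv K := by
    rw [stencilOperator_eq, mul_add, add_mul, add_mul, add_assoc]
  rw [e] at hsum
  refine hsum.unique ?_
  have hterm : ∀ t : ℤ, gridMatrix A₀ * (gridMatrix (K t) * gridShift d t) +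
      gridMatrix (A₁ * K (t - 1)) * gridShift d t +
      gridMatrix (A₁ * K (t - -1)) * gridShift d t =
        gridMatrix (if t = 0 then 1 else 0) * gridShift d t := by
    intro t
    rw [← h t, gridMatrix_add, mul_add A₁, gridMatrix_add, gridMatrix_mul A₀, add_mul, add_mul,
      mul_assoc, sub_neg_eq_add, add_assoc]
  simp only [hterm]
  have hone := hasSum_single (f := fun t : ℤ =>
    gridMatrix (if t = 0 then (1 : Matrix (Fin d) (Fin d) ℝ) else 0) * gridShift d t) 0
    (fun t ht => by rw [if_neg ht, gridMatrix_zero, zero_mul])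
  rwa [if_pos rfl, gridMatrix_one, gridShift_zero, mul_one] at hone

/-- Commutation upgrades a right inverse to a two-sided one. Summability plays no role: a divergent
`tsum` is 0. -/
theorem stencilOperator_commute_kernelConv {d : ℕ} {A₀ A₁ : Matrix (Fin d) (Fin d) ℝ}
    {K : ℤ → Matrix (Fin d) (Fin d) ℝ} (h₀ : ∀ t, Commute A₀ (K t)) (h₁ : ∀ t, Commute A₁ (K t)) :
    Commute (stencilOperator A₀ A₁) (kernelConv K) := by
  have hM : ∀ {B C : Matrix (Fin d) (Fin d) ℝ}, Commute B C →
      Commute (gridMatrix B) (gridMatrix C) := by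
    intro B C hBC
    rw [Commute, SemiconjBy, ← gridMatrix_mul, hBC.eq, gridMatrix_mul]
  have hS : ∀ s t, Commute (gridShift d s) (gridShift d t) := by
    intro s t
    rw [Commute, SemiconjBy, gridShift_mul, gridShift_mul, add_comm]
  refine Commute.tsum_right _ fun t => ?_
  rw [stencilOperator_eq]
  refine Commute.add_left ?_ (Commute.mul_left ?_ (Commute.add_left ?_ ?_))
  · exact (hM (h₀ t)).mul_right (gridShift_commute_gridMatrix _ _).symm
  · exact (hM (h₁ t)).mul_right (gridShift_commute_gridMatrix _ _).symm
  · exact (gridShift_commute_gridMatrix _ _).mul_right (hS _ _)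
  · exact (gridShift_commute_gridMatrix _ _).mul_right (hS _ _)

end KernelOperators

/-! ### The Green's kernel as a superposition of geometric sequences -/

section GreenKernel

theorem exists_decaying_root {a b : ℝ} (h : 2 * |b| < a) :
    ∃ r : ℝ, |r| < 1 ∧ b * r ^ 2 + a * r + b = 0 ∧ a + 2 * b * r ≠ 0 := by
  have ha : 0 < a := lt_of_le_of_lt (by positivity) h
  have hd : 0 < a ^ 2 - 4 * b ^ 2 := by
    have := pow_lt_pow_left₀ h (by positivity) two_ne_zero
    rw [mul_pow, sq_abs] at this
    linarith
  set s := √(a ^ 2 - 4 * b ^ 2) with hs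
  have hs0 : 0 < s := Real.sqrt_pos.2 hd
  have hs2 : s ^ 2 = a ^ 2 - 4 * b ^ 2 := Real.sq_sqrt hd.le
  have hD : 0 < a + s := by linarith
  -- The smaller root, written with the radical in the denominator so that b = 0 is included. Then a
  -- + 2br = s > 0.
  refine ⟨-(2 * b) / (a + s), ?_, ?_, ?_⟩
  · rw [abs_div, abs_of_pos hD, div_lt_one hD, abs_neg, abs_mul, abs_two]
    linarith
  · field_simp
    linear_combination b * hs2
  · have e : a + 2 * b * (-(2 * b) / (a + s)) = s := by
      field_simp
      linear_combination -hs2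
    rw [e]
    exact hs0.ne'

/-- Away from 0 the numbers |t ± 1| are |t| ± 1 in some order and the recurrence applies; at 0 both
neighbours equal r. -/
theorem pow_natAbs_stencil {a b r : ℝ} (hr : b * r ^ 2 + a * r + b = 0) (t : ℤ) :
    a * r ^ t.natAbs + b * (r ^ (t - 1).natAbs + r ^ (t + 1).natAbs) =
      if t = 0 then a + 2 * b * r else 0 := by
  split_ifs with ht
  · subst ht
    norm_num
    ring
  · obtain ⟨k, hk⟩ : ∃ k : ℕ, t.natAbs = k + 1 := ⟨t.natAbs - 1, by omega⟩
    have h2 : r ^ (t - 1).natAbs + r ^ (t + 1).natAbs = r ^ k + r ^ (k + 2) := by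
      rcases lt_or_gt_of_ne ht with h | h
      · rw [show (t - 1).natAbs = k + 2 by omega, show (t + 1).natAbs = k by omega, add_comm]
      · rw [show (t - 1).natAbs = k by omega, show (t + 1).natAbs = k + 2 by omega]
    rw [h2, hk]
    linear_combination r ^ k * hr

/-- Simultaneous spectral decomposition of two commuting symmetric matrices. -/
theorem exists_joint_spectral_projections {d : ℕ} {A₀ A₁ : Matrix (Fin d) (Fin d) ℝ}
    (hA₀ : A₀.IsSymm) (hA₁ : A₁.IsSymm) (hcomm : Commute A₀ A₁) :
    ∃ (a b : Fin d → ℝ) (P : Fin d → Matrix (Fin d) (Fin d) ℝ),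
      (∀ q, IsJointEigenpair A₀ A₁ (a q) (b q)) ∧ ∑ q, P q = 1 ∧
        (∀ q, A₀ * P q = a q • P q) ∧ (∀ q, A₁ * P q = b q • P q) ∧
          (∀ q, Commute A₀ (P q)) ∧ ∀ q, Commute A₁ (P q) := by
  have hS : ∀ {A : Matrix (Fin d) (Fin d) ℝ}, A.IsSymm → A.toEuclideanLin.IsSymmetric := by
    intro A hA
    refine Matrix.isSymmetric_toEuclideanLin_iff.2 ?_
    rw [Matrix.IsHermitian, Matrix.conjTranspose_eq_transpose_of_trivial]
    exact hA
  have hC : Commute A₀.toEuclideanLin A₁.toEuclideanLin := by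
    refine LinearMap.ext fun v => ?_
    simp [Matrix.toLpLin_apply, hcomm.eq]
  have hint := LinearMap.IsSymmetric.directSum_isInternal_of_commute (hS hA₀) (hS hA₁) hC
  let β₀ := hint.collectedBasis fun i => Module.finBasis ℝ _
  have hβ₀ := fun k => hint.collectedBasis_mem (fun i => Module.finBasis ℝ _) k
  let e := β₀.indexEquiv (EuclideanSpace.basisFun (Fin d) ℝ).toBasis
  let β : Module.Basis (Fin d) ℝ (Fin d → ℝ) :=
    (β₀.reindex e).map (WithLp.linearEquiv 2 ℝ (Fin d → ℝ))
  have hβ : ∀ q, β q = (β₀ (e.symm q)).ofLp := fun q => by simp [β]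
  let b : Fin d → ℝ := fun q => (e.symm q).1.1
  let a : Fin d → ℝ := fun q => (e.symm q).1.2
  have ha : ∀ q, A₀.mulVec (β q) = a q • β q := fun q => by
    have h := Module.End.mem_eigenspace_iff.1 (hβ₀ (e.symm q)).1
    rw [hβ]
    exact congrArg WithLp.ofLp h
  have hb : ∀ q, A₁.mulVec (β q) = b q • β q := fun q => by
    have h := Module.End.mem_eigenspace_iff.1 (hβ₀ (e.symm q)).2
    rw [hβ]
    exact congrArg WithLp.ofLp h
  -- Coordinate projections of a basis of joint eigenvectors. They need not be orthogonal: only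
  -- their sum and their products with `A₀` and `A₁` matter.
  let P : Fin d → Matrix (Fin d) (Fin d) ℝ :=
    fun q => LinearMap.toMatrix' ((β.coord q).smulRight (β q))
  have hP : ∀ q j, (P q).mulVec (β j) = if j = q then β q else 0 := fun q j => by
    rw [← Matrix.toLin'_apply, Matrix.toLin'_toMatrix', LinearMap.smulRight_apply,
      Module.Basis.coord_apply, Module.Basis.repr_self, Finsupp.single_apply]
    split_ifs <;> simp
  have hext : ∀ {M M' : Matrix (Fin d) (Fin d) ℝ},
      (∀ j, M.mulVec (β j) = M'.mulVec (β j)) → M = M' := fun h =>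
    Matrix.toLin'.injective (β.ext fun j => by simpa using h j)
  have hmul : ∀ {A : Matrix (Fin d) (Fin d) ℝ} {c : Fin d → ℝ},
      (∀ q, A.mulVec (β q) = c q • β q) → ∀ q, A * P q = c q • P q ∧ Commute A (P q) := by
    intro A c hA q
    refine ⟨hext fun j => ?_, hext fun j => ?_⟩
    · rw [← Matrix.mulVec_mulVec, Matrix.smul_mulVec, hP]
      split_ifs
      · exact hA q
      · simp
    · rw [← Matrix.mulVec_mulVec, ← Matrix.mulVec_mulVec, hA, Matrix.mulVec_smul, hP]
      split_ifs with h
      · rw [hA, h]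
      · simp
  refine ⟨a, b, P, fun q => ⟨β q, β.ne_zero q, ha q, hb q⟩, hext fun j => ?_,
    fun q => (hmul ha q).1, fun q => (hmul hb q).1, fun q => (hmul ha q).2, fun q => (hmul hb q).2⟩
  rw [Matrix.sum_mulVec, Matrix.one_mulVec]
  simp [hP]

/-- The inverse of the stencil operator is the convolution with a superposition of two-sided
geometric sequences. -/
theorem exists_geometric_green_kernel {d : ℕ} {A₀ A₁ : Matrix (Fin d) (Fin d) ℝ}
    (hA₀ : A₀.IsSymm) (hA₁ : A₁.IsSymm) (hcomm : Commute A₀ A₁)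
    (hstable : ∀ a b : ℝ, IsJointEigenpair A₀ A₁ a b → 2 * |b| < a) :
    ∃ (r : Fin d → ℝ) (Q : Fin d → Matrix (Fin d) (Fin d) ℝ), (∀ q, |r q| < 1) ∧
      ∀ K : ℤ → Matrix (Fin d) (Fin d) ℝ, (∀ t, K t = ∑ q, r q ^ t.natAbs • Q q) →
        (Summable fun t => matOpNorm (K t)) →
          stencilOperator A₀ A₁ * kernelConv K = 1 ∧ kernelConv K * stencilOperator A₀ A₁ = 1 := by
  obtain ⟨a, b, P, hpair, hsum, h₀, h₁, hc₀, hc₁⟩ :=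
    exists_joint_spectral_projections hA₀ hA₁ hcomm
  choose r hr hroot hne using fun q => exists_decaying_root (hstable _ _ (hpair q))
  -- The factor (a + 2br)⁻¹ normalizes the value of the stencil at 0 to `P q`.
  refine ⟨r, fun q => (a q + 2 * b q * r q)⁻¹ • P q, hr, fun K hK hs => ?_⟩
  have hleft : stencilOperator A₀ A₁ * kernelConv K = 1 := by
    refine stencilOperator_mul_kernelConv hs fun t => ?_
    have hterm : ∀ q, A₀ * (r q ^ t.natAbs • (a q + 2 * b q * r q)⁻¹ • P q) +
        A₁ * (r q ^ (t - 1).natAbs • (a q + 2 * b q * r q)⁻¹ • P q +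
          r q ^ (t + 1).natAbs • (a q + 2 * b q * r q)⁻¹ • P q) =
        if t = 0 then P q else 0 := by
      intro q
      have h := pow_natAbs_stencil (hroot q) t
      have e : A₀ * (r q ^ t.natAbs • (a q + 2 * b q * r q)⁻¹ • P q) +
          A₁ * (r q ^ (t - 1).natAbs • (a q + 2 * b q * r q)⁻¹ • P q +
            r q ^ (t + 1).natAbs • (a q + 2 * b q * r q)⁻¹ • P q) =
          ((a q * r q ^ t.natAbs + b q * (r q ^ (t - 1).natAbs + r q ^ (t + 1).natAbs)) *
            (a q + 2 * b q * r q)⁻¹) • P q := by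
        simp only [mul_add, Matrix.mul_smul, h₀, h₁]
        module
      rw [e, h]
      split_ifs
      · rw [mul_inv_cancel₀ (hne q), one_smul]
      · rw [zero_mul, zero_smul]
    rw [hK, hK, hK, ← Finset.sum_add_distrib, Finset.mul_sum, Finset.mul_sum,
      ← Finset.sum_add_distrib, Finset.sum_congr rfl fun q _ => hterm q]
    split_ifs
    · exact hsum
    · exact Finset.sum_const_zero
  refine ⟨hleft, ?_⟩
  rw [← hleft]
  refine (stencilOperator_commute_kernelConv (fun t => ?_) fun t => ?_).eq.symm
  · rw [hK]
    exact Commute.sum_right _ _ _ fun q _ => ((hc₀ q).smul_right _).smul_right _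
  · rw [hK]
    exact Commute.sum_right _ _ _ fun q _ => ((hc₁ q).smul_right _).smul_right _

end GreenKernel

/-! ### Constants and assembly -/

section Learnability

theorem summable_exp_neg_natAbs {κ : ℝ} (hκ : 0 < κ) :
    Summable fun t : ℤ => Real.exp (-κ * t.natAbs) := by
  have h : Summable fun n : ℕ => Real.exp (-κ * n) := by
    have := Real.summable_exp_nat_mul_iff.2 (neg_lt_zero.2 hκ)
    simpa only [mul_comm] using this
  exact Summable.of_nat_of_neg (by simpa using h) (by simpa using h)

/-- The filter argument also covers an empty family, as occurs for d = 0. -/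
theorem exists_common_pos_le {ι : Type*} [Finite ι] {c : ι → ℝ} (hc : ∀ i, 0 < c i) :
    ∃ c₀ : ℝ, 0 < c₀ ∧ ∀ i, c₀ ≤ c i := by
  have h : ∀ᶠ x in nhdsWithin (0 : ℝ) (Set.Ioi 0), 0 < x ∧ ∀ i, x ≤ c i :=
    eventually_mem_nhdsWithin.and (Filter.eventually_all.2 fun i =>
      (Filter.eventually_of_mem (Ioc_mem_nhdsGT (hc i)) fun _ hx => hx.2))
  exact h.exists

theorem exists_abs_le_exp_neg {ι : Type*} [Finite ι] {r : ι → ℝ} (hr : ∀ i, |r i| < 1) :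
    ∃ κ : ℝ, 0 < κ ∧ ∀ i, |r i| ≤ Real.exp (-(2 * κ)) := by
  -- Then |r i| ≤ 1 - 2κ ≤ exp(-2κ), which avoids taking the logarithm of a root that may vanish.
  have h1 : ∀ i, 0 < (1 - |r i|) / 2 := fun i => by have := hr i; linarith
  obtain ⟨κ, hκ, h⟩ := exists_common_pos_le h1
  refine ⟨κ, hκ, fun i => ?_⟩
  have := Real.add_one_le_exp (-(2 * κ))
  have := h i
  linarith

theorem clog_two_add_one_le (N : ℕ) :
    ((Nat.clog 2 (N + 1 + 1) + 1 : ℕ) : ℝ) ≤ 6 * Real.log (N + 2) := by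
  have hlog2 : 1 / 2 ≤ Real.log 2 := by have := Real.log_two_gt_d9; linarith
  have hmono : Real.log 2 ≤ Real.log (N + 2) := Real.log_le_log two_pos (by
    have : (0 : ℝ) ≤ N := by positivity
    linarith)
  obtain ⟨k, hk⟩ : ∃ k, Nat.clog 2 (N + 1 + 1) = k + 1 :=
    ⟨Nat.clog 2 (N + 1 + 1) - 1, by have := Nat.clog_pos (b := 2) (n := N + 1 + 1) (by norm_num)
                                      (by omega)
                                    omega⟩
  have h1 : 2 ^ k < N + 2 := by
    have := Nat.pow_pred_clog_lt_self (b := 2) (by norm_num) (x := N + 1 + 1) (by omega)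
    rwa [hk] at this
  have h2 : (k : ℝ) * Real.log 2 ≤ Real.log (N + 2) := by
    rw [← Real.log_pow]
    refine Real.log_le_log (by positivity) ?_
    exact_mod_cast h1.le
  have h3 : (k : ℝ) * (1 / 2) ≤ k * Real.log 2 := by gcongr
  rw [hk]
  push_cast
  linarith

theorem usbKernel_of_natAbs_le {d N L : ℕ} {φ : Fin (N + 1) → EuclideanSpace ℝ (Fin (N + 1))}
    (hL : L ≤ N + 1) (Θ : Fin L → Matrix (Fin d) (Fin d) ℝ) {t : ℤ} (ht : t.natAbs ≤ N) :
    usbKernel φ hL Θ t =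
      ∑ l : Fin L, φ (Fin.castLE hL l) ⟨t.natAbs, Nat.lt_succ_of_le ht⟩ • Θ l := by
  rw [usbKernel, dif_pos (Nat.lt_succ_of_le ht)]

/-- Replacing each scalar sequence in a superposition by its approximation in the leading modes. -/
theorem matOpNorm_sub_usbKernel_le {d N L : ℕ}
    {φ : Fin (N + 1) → EuclideanSpace ℝ (Fin (N + 1))} (hL : L ≤ N + 1)
    {r : Fin d → ℝ} {Q : Fin d → Matrix (Fin d) (Fin d) ℝ} {θ : Fin d → Fin L → ℝ} {δ : ℝ}
    (hθ : ∀ q, ∀ i : Fin (N + 1),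
      |r q ^ (i : ℕ) - ∑ l : Fin L, φ (Fin.castLE hL l) i * θ q l| ≤ δ)
    {t : ℤ} (ht : t.natAbs ≤ N) :
    matOpNorm (∑ q, r q ^ t.natAbs • Q q - usbKernel φ hL (fun l => ∑ q, θ q l • Q q) t) ≤
      (∑ q, matOpNorm (Q q)) * δ := by
  set i : Fin (N + 1) := ⟨t.natAbs, Nat.lt_succ_of_le ht⟩
  have e : ∑ q, r q ^ t.natAbs • Q q - usbKernel φ hL (fun l => ∑ q, θ q l • Q q) t =
      ∑ q, (r q ^ (i : ℕ) - ∑ l : Fin L, φ (Fin.castLE hL l) i * θ q l) • Q q := by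
    rw [usbKernel_of_natAbs_le hL _ ht]
    simp only [sub_smul, Finset.sum_sub_distrib, Finset.smul_sum, Finset.sum_smul, smul_smul]
    rw [Finset.sum_comm]
  rw [e]
  refine (matOpNorm_sum_le _ _).trans ?_
  rw [Finset.sum_mul]
  refine Finset.sum_le_sum fun q _ => ?_
  rw [matOpNorm_smul, mul_comm]
  exact mul_le_mul_of_nonneg_left (hθ q i) (matOpNorm_nonneg _)

theorem matOpNorm_sum_pow_smul_le {d : ℕ} {r : Fin d → ℝ} {Q : Fin d → Matrix (Fin d) (Fin d) ℝ}
    {κ : ℝ} (hκ : ∀ q, |r q| ≤ Real.exp (-(2 * κ))) (n : ℕ) :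
    matOpNorm (∑ q, r q ^ n • Q q) ≤ (∑ q, matOpNorm (Q q)) * Real.exp (-(2 * κ) * n) := by
  refine (matOpNorm_sum_le _ _).trans ?_
  rw [Finset.sum_mul]
  refine Finset.sum_le_sum fun q _ => ?_
  rw [matOpNorm_smul, mul_comm, abs_pow, mul_comm (-(2 * κ)), Real.exp_nat_mul]
  exact mul_le_mul_of_nonneg_left (pow_le_pow_left₀ (abs_nonneg _) (hκ q) n) (matOpNorm_nonneg _)

end Learnability

theorem theoremG1 (d : ℕ) (A₀ A₁ : Matrix (Fin d) (Fin d) ℝ)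
    (hA₀ : A₀.IsSymm) (hA₁ : A₁.IsSymm) (hcomm : Commute A₀ A₁)
    (hstable : ∀ a b : ℝ, IsJointEigenpair A₀ A₁ a b → 2 * |b| < a) :
    ∃ Ainv : GridL2 d →L[ℝ] GridL2 d,
      (stencilOperator A₀ A₁).comp Ainv = ContinuousLinearMap.id ℝ (GridL2 d) ∧
      Ainv.comp (stencilOperator A₀ A₁) = ContinuousLinearMap.id ℝ (GridL2 d) ∧
      ∃ C : ℝ, 0 < C ∧ ∀ ε : ℝ, 0 < ε → ∀ N : ℕ,
        ∀ φ : Fin (N + 1) → EuclideanSpace ℝ (Fin (N + 1)), IsUSB (N + 1) φ →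
          ∃ (L : ℕ) (hL : L ≤ N + 1) (Θ : Fin L → Matrix (Fin d) (Fin d) ℝ),
            (L : ℝ) ≤ C * Real.log (N + 2) ^ 2 * Real.log (2 + 1 / ε) ∧
            ‖windowConv N (impulseResponse Ainv) - sfoOperator φ hL Θ‖ ≤ ε ∧
            (C * Real.log (2 + 1 / ε) ≤ N → ‖Ainv - sfoOperator φ hL Θ‖ ≤ ε) := by
  obtain ⟨r, Q, hr, hinv⟩ := exists_geometric_green_kernel hA₀ hA₁ hcomm hstable
  obtain ⟨κ, hκ, hrκ⟩ := exists_abs_le_exp_neg hr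
  choose c' hc' happrox using fun q => exists_abs_pow_sub_sum_modes_le (hr q)
  obtain ⟨c, hc, hcc'⟩ := exists_common_pos_le hc'
  set B₀ : ℝ := ∑ q, matOpNorm (Q q)
  have hB₀0 : 0 ≤ B₀ := Finset.sum_nonneg fun q _ => matOpNorm_nonneg _
  set G : ℤ → Matrix (Fin d) (Fin d) ℝ := fun t => ∑ q, r q ^ t.natAbs • Q q
  have hGle : ∀ t, matOpNorm (G t) ≤ B₀ * Real.exp (-(2 * κ) * t.natAbs) :=
    fun t => matOpNorm_sum_pow_smul_le hrκ _
  have hsum : Summable fun t => matOpNorm (G t) :=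
    Summable.of_nonneg_of_le (fun t => matOpNorm_nonneg _) hGle
      ((summable_exp_neg_natAbs (by positivity : 0 < 2 * κ)).mul_left B₀)
  obtain ⟨hAG, hGA⟩ := hinv G (fun t => rfl) hsum
  refine ⟨kernelConv G, hAG, hGA, ?_⟩
  -- Adding 1 keeps the logarithms b and b' below nonnegative even if B₀ = 0.
  set B : ℝ := B₀ + 1
  have hsκ := summable_exp_neg_natAbs hκ
  set S : ℝ := ∑' t : ℤ, Real.exp (-κ * t.natAbs)
  have hS : 0 ≤ S := tsum_nonneg fun t => (Real.exp_pos _).le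
  set b : ℝ := Real.log (16 * B)
  set b' : ℝ := Real.log (2 * B * (S + 1))
  have hB1 : 1 ≤ B := by simp only [B]; linarith
  have hb : 0 ≤ b := Real.log_nonneg (by linarith)
  have hb' : 0 ≤ b' := Real.log_nonneg (by nlinarith)
  -- Since lam, ell ≥ 1/2, one has b ≤ 4b·lam·ell, 3 lam ≤ 6 lam·ell and ell ≤ 2 lam·ell. Hence
  -- cK·lam·ell ≥ b + 3 lam + ell.
  set K : ℝ := (8 + 4 * b) / c
  have hK : 0 < K := by positivity
  -- The first summand bounds L: the node count is at most 6 lam and m ≤ (K + 4)·lam·ell. The second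
  -- makes κN ≥ b' + ell for the tail.
  refine ⟨6 * (K + 4) + (1 + 2 * b') / κ, by positivity, fun ε hε N φ hφ => ?_⟩
  have hlog2 : 1 / 2 ≤ Real.log 2 := by have := Real.log_two_gt_d9; linarith
  have hN0 : (0 : ℝ) ≤ N := N.cast_nonneg
  set lam : ℝ := Real.log (N + 2)
  set ell : ℝ := Real.log (2 + 1 / ε)
  have hε' : 0 < 1 / ε := by positivity
  have hlam : 1 / 2 ≤ lam := hlog2.trans (Real.log_le_log two_pos (by linarith))
  have hell : 1 / 2 ≤ ell := hlog2.trans (Real.log_le_log two_pos (by linarith))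
  have hlam0 : 0 < lam := by linarith
  have hell0 : 0 < ell := by linarith
  have hexpell : Real.exp (-ell) ≤ ε := by
    rw [Real.exp_neg, Real.exp_log (by positivity)]
    refine inv_le_of_inv_le₀ hε ?_
    rw [← one_div]; linarith
  set m : ℕ := ⌈K * lam * ell⌉₊
  have hm1 : K * lam * ell ≤ m := Nat.le_ceil _
  have hm2 : (m : ℝ) ≤ K * lam * ell + 1 := (Nat.ceil_lt_add_one (by positivity)).le
  set L : ℕ := min (N + 1) ((Nat.clog 2 (N + 1 + 1) + 1) * m)
  have hL : L ≤ N + 1 := min_le_left _ _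
  choose θ hθ using fun q => happrox q (N + 1) N.succ_pos φ hφ m L hL le_rfl
  have hlamell : 1 / 4 ≤ lam * ell := by nlinarith
  have hwin : ‖windowConv N G - sfoOperator φ hL (fun l => ∑ q, θ q l • Q q)‖ ≤ ε / 2 := by
    have hδ : ∀ q, ∀ i : Fin (N + 1),
        |r q ^ (i : ℕ) - ∑ l : Fin L, φ (Fin.castLE hL l) i * θ q l| ≤
          4 * ((N + 1 : ℕ) : ℝ) ^ 2 * Real.exp (-c * m) := fun q i => by
      refine (hθ q i).trans ?_
      have : Real.exp (-c' q * m) ≤ Real.exp (-c * m) := by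
        refine Real.exp_le_exp.2 (mul_le_mul_of_nonneg_right ?_ m.cast_nonneg)
        linarith [hcc' q]
      gcongr
    refine (norm_windowConv_sub_le fun t ht => matOpNorm_sub_usbKernel_le hL hδ ht).trans ?_
    have hcm : b + 3 * lam + ell ≤ c * m := by
      have h1 : c * (K * lam * ell) ≤ c * m := mul_le_mul_of_nonneg_left hm1 hc.le
      have h2 : c * (K * lam * ell) = (8 + 4 * b) * (lam * ell) := by
        simp only [K]; field_simp
      have h3 : b * (1 / 4) ≤ b * (lam * ell) := mul_le_mul_of_nonneg_left hlamell hb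
      have h4 : lam * (1 / 2) ≤ lam * ell := mul_le_mul_of_nonneg_left hell hlam0.le
      have h5 : 1 / 2 * ell ≤ lam * ell := mul_le_mul_of_nonneg_right hlam hell0.le
      linarith
    -- The window has at most 2(N+2) offsets, each with error at most 4B(N+2)² exp(-cm); the
    -- constant 16 leaves a total of exp(-ell)/2.
    have hexp : Real.exp (-c * m) ≤ Real.exp (-ell) / (16 * B * (N + 2) ^ 3) := by
      have e : Real.exp (-ell) / (16 * B * (N + 2) ^ 3) = Real.exp (-ell - b - 3 * lam) := by
        rw [Real.exp_sub, Real.exp_sub, Real.exp_log (by positivity), div_div]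
        congr 2
        rw [show (3 : ℝ) * lam = (3 : ℕ) * lam by norm_num, Real.exp_nat_mul,
          Real.exp_log (by positivity)]
      rw [e]
      exact Real.exp_le_exp.2 (by linarith)
    calc (2 * (N : ℝ) + 1) * ((∑ q, matOpNorm (Q q)) *
          (4 * ((N + 1 : ℕ) : ℝ) ^ 2 * Real.exp (-c * m)))
        ≤ (2 * ((N : ℝ) + 2)) * (B * (4 * ((N : ℝ) + 2) ^ 2 *
            (Real.exp (-ell) / (16 * B * (N + 2) ^ 3)))) := by
          push_cast
          have : ∑ q, matOpNorm (Q q) ≤ B := by simp only [B]; linarith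
          gcongr
          · linarith
          · norm_num
      _ = Real.exp (-ell) / 2 := by
          have : B ≠ 0 := by positivity
          field_simp
          norm_num
      _ ≤ ε / 2 := by linarith
  refine ⟨L, hL, fun l => ∑ q, θ q l • Q q, ?_, ?_, fun hN => ?_⟩
  · have h1 : (L : ℝ) ≤ ((Nat.clog 2 (N + 1 + 1) + 1 : ℕ) : ℝ) * m := by
      exact_mod_cast min_le_right (N + 1) ((Nat.clog 2 (N + 1 + 1) + 1) * m)
    have h2 : (m : ℝ) ≤ (K + 4) * (lam * ell) := by linarith
    calc (L : ℝ) ≤ _ := h1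
      _ ≤ 6 * lam * ((K + 4) * (lam * ell)) := by
          gcongr
          exact clog_two_add_one_le N
      _ = 6 * (K + 4) * lam ^ 2 * ell := by ring
      _ ≤ _ := by
          gcongr
          have : 0 ≤ (1 + 2 * b') / κ := by positivity
          linarith
  · rw [impulseResponse_kernelConv hsum]
    linarith
  · have htail : ‖kernelConv G - windowConv N G‖ ≤ ε / 2 := by
      refine (norm_kernelConv_sub_windowConv_le hκ hB₀0 hsκ hGle N).trans ?_
      have hκN : b' + ell ≤ κ * N := by
        have h1 : (1 + 2 * b') / κ * ell ≤ N := by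
          refine le_trans ?_ hN
          gcongr
          have : 0 < 6 * (K + 4) := by positivity
          linarith
        have h2 : (1 + 2 * b') * ell ≤ κ * N := by
          have := mul_le_mul_of_nonneg_left h1 hκ.le
          rwa [← mul_assoc, mul_div_cancel₀ _ hκ.ne'] at this
        have h3 : b' * (1 / 2) ≤ b' * ell := mul_le_mul_of_nonneg_left hell hb'
        linarith
      have hexp : Real.exp (-κ * N) ≤ Real.exp (-ell) / (2 * B * (S + 1)) := by
        have e : Real.exp (-ell) / (2 * B * (S + 1)) = Real.exp (-ell - b') := by
          rw [Real.exp_sub, Real.exp_log (by positivity)]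
        rw [e]
        exact Real.exp_le_exp.2 (by linarith)
      calc B₀ * Real.exp (-κ * N) * S
          ≤ B * (Real.exp (-ell) / (2 * B * (S + 1))) * (S + 1) := by
            gcongr
            · simp only [B]; linarith
            · linarith
        _ = Real.exp (-ell) / 2 := by
            have : B ≠ 0 := by positivity
            field_simp
        _ ≤ ε / 2 := by linarith
    calc ‖kernelConv G - sfoOperator φ hL (fun l => ∑ q, θ q l • Q q)‖
        ≤ ‖kernelConv G - windowConv N G‖ +
            ‖windowConv N G - sfoOperator φ hL (fun l => ∑ q, θ q l • Q q)‖ :=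
          norm_sub_le_norm_sub_add_norm_sub _ _ _
      _ ≤ ε := by linarith
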